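/- Let $H$ be a separable infinite-dimensional complex Hilbert space with a fixed orthonormal basis $(e_n)_{n\ge 1}$, $\mathcal K(H)$ the compact operators, $\mathcal K(H)^{ah}$ the anti-Hermitian compact operators, $\mathrm{Diag}(d_n)$ the diagonal operator in this basis of a bounded sequence $(d_n)$, and $\mathcal U_c=\{u \text{ unitary}: u-I\in\mathcal K(H)\}$. Let $(\lambda_i)_{i\ge1}$ be real numbers with $\lambda_i\ne\lambda_j$ for $i\neq j$, let $b=\mathrm{Diag}(\lambda_i)$ and $A=ubu^*$ with $u\in\mathcal U_c$, and assume that $A$ is compact. Put $\mathcal O_A=\{wAw^*:w\in\mathcal U_c\}$. For $c\in\mathcal O_A$ the tangent space is $T_c=\{Yc-cY:Y\in\mathcal K(H)^{ah}\}$, with Finsler norm $\|x\|_c=\inf\{\|Y\|:Y\in\mathcal K(H)^{ah},\ Yc-cY=x\}$. A smooth curve in $\mathcal O_A$ is a $C^1$ map $\beta$ (for the operator norm) from a compact interval into $\mathcal O_A$ with $0\ne\beta'(t)\in T_{\beta(t)}$ for all $t$; its length is $L(\beta)=\int\|\beta'(t)\|_{\beta(t)}\,dt\in[0,\infty]$,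 and $\mathrm{dist}(c_1,c_2)$ is the infimum of the lengths of the smooth curves in $\mathcal O_A$ joining $c_1$ and $c_2$. A minimal lifting of $x\in T_c$ is a bounded anti-Hermitian $Z$ with $Zc-cZ=x$ and $\|Z\|=\|x\|_c$. Let $\gamma\in\mathbb R$, $0<|\gamma|<1$. For $j\ge2$ put $d_j=-\frac{1-\gamma^{j-2}}{1-\gamma}-\frac{\gamma^j}{1-\gamma^2}$, and $D_0=i\,\mathrm{Diag}(0,d_2,d_3,\dots)$. Let $Y^{[1]}$ be the operator whose matrix has the entries $i\gamma^{\max(k,l)-2}$ for $k\ne l$, $k,l\ge2$, and zeros elsewhere. Let $r\ge \|Y^{[1]}+D_0\|\big/\big(\sum_{k\ge1}\gamma^{2k}\big)^{1/2}$. Let $Y_r$ be the operator obtained from $Y^{[1]}$ by changing, for all $j\ge2$, the entries $(1,j)$ and $(j,1)$ to $ir\gamma^{j-1}$, and let $Z_r=Y_r+D_0$. Put $x=Z_rb-bZ_r$ and $\sigma(t)=e^{tZ_r}be^{-tZ_r}$ for $t\in\mathbb R$. Then: 0. $Z_r$ is anti-Hermitian, bounded and not compact, and it is minimal: $\|Z_r\|\le\|Z_r+D\|$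 for every bounded diagonal operator $D$. 1. With $Z_\alpha=Z_r+\frac{i}{1-\gamma}I$, one has $Z_\alpha\in\mathcal K(H)^{ah}$, and for every $t\in\mathbb R$: $e^{tZ_\alpha}\in\mathcal U_c$ and $\sigma(t)=e^{tZ_\alpha}be^{-tZ_\alpha}\in\mathcal O_A$. 2. $\sigma'(0)=x=Y_rb-bY_r\in T_b$. 3. For every $t_0\in\mathbb R$ with $|t_0|\le\pi/(2\|Z_r\|)$, the restriction of $\sigma$ to the interval between $0$ and $t_0$ is a smooth curve in $\mathcal O_A$, and it has minimal length among the curves in $\mathcal O_A$ from $b$ to $\sigma(t_0)$: its length is equal to $\inf\{L(\chi):\chi \text{ smooth in }\mathcal O_A \text{ on the same interval},\ \chi(0)=b,\ \chi(t_0)=\sigma(t_0)\}$ and to $\mathrm{dist}(b,\sigma(t_0))$; moreover it is at most $L(\chi)$ for every $C^1$ curve $\chi$ in $\mathcal O_A$ on the same interval with the same end points and with $\chi'(t)\in T_{\chi(t)}$ for all $t$, even if $\chi'$ vanishes somewhere. 4. For the same $t_0$, this length is $|t_0|\,\|x\|_b$. 5. $Z_r$ is a minimal lifting of $x$, and no minimal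 lifting of $x$ is compact. -/

import Mathlib

open scoped Topology ENNReal

namespace FredholmOrbit

/-! ### Operators given by infinite matrices -/

section MatrixOperators

/-- `T` is the bounded operator whose infinite matrix in the orthonormal basis `e` is `M`. -/
def HasMatrix {H : Type*} [NormedAddCommGroup H] [InnerProductSpace ℂ H]
    (e : HilbertBasis ℕ ℂ H) (T : H →L[ℂ] H) (M : ℕ → ℕ → ℂ) : Prop :=
  ∀ i j, inner ℂ (e i) (T (e j)) = M i j

/-- A bounded operator is determined by its matrix. -/
theorem HasMatrix.unique {H : Type*} [NormedAddCommGroup H] [InnerProductSpace ℂ H]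
    {e : HilbertBasis ℕ ℂ H} {T S : H →L[ℂ] H} {M : ℕ → ℕ → ℂ}
    (hT : HasMatrix e T M) (hS : HasMatrix e S M) : T = S := by
  have key : ∀ j, T (e j) = S (e j) := by
    intro j
    apply e.repr.injective
    ext i
    rw [e.repr_apply_apply, e.repr_apply_apply, hT i j, hS i j]
  refine ContinuousLinearMap.ext_on (s := Set.range e) ?_ ?_
  · rw [Submodule.dense_iff_topologicalClosure_eq_top]
    exact e.dense_span
  · rintro _ ⟨j, rfl⟩
    exact key j

open Classical in
/-- The bounded operator with infinite matrix `M` in the basis `e`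
(zero if no bounded operator has this matrix). -/
noncomputable def matrixOp {H : Type*} [NormedAddCommGroup H] [InnerProductSpace ℂ H]
    (e : HilbertBasis ℕ ℂ H) (M : ℕ → ℕ → ℂ) : H →L[ℂ] H :=
  if h : ∃ T : H →L[ℂ] H, HasMatrix e T M then h.choose else 0

theorem HasMatrix.matrixOp_eq {H : Type*} [NormedAddCommGroup H] [InnerProductSpace ℂ H]
    {e : HilbertBasis ℕ ℂ H} {T : H →L[ℂ] H} {M : ℕ → ℕ → ℂ}
    (hT : HasMatrix e T M) : matrixOp e M = T := by
  have h : ∃ T : H →L[ℂ] H, HasMatrix e T M := ⟨T, hT⟩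
  rw [matrixOp, dif_pos h]
  exact h.choose_spec.unique hT

theorem HasMatrix.hasMatrix_matrixOp {H : Type*} [NormedAddCommGroup H] [InnerProductSpace ℂ H]
    {e : HilbertBasis ℕ ℂ H} {T : H →L[ℂ] H} {M : ℕ → ℕ → ℂ}
    (hT : HasMatrix e T M) : HasMatrix e (matrixOp e M) M := by
  rw [hT.matrixOp_eq]; exact hT

/-- The matrix with the sequence `d` on the diagonal and `0` elsewhere. -/
def diagMatrix (d : ℕ → ℂ) : ℕ → ℕ → ℂ := fun i j => if i = j then d i else 0

/-- `Diag(d)`, for a bounded sequence `d`. -/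
noncomputable def diagOp {H : Type*} [NormedAddCommGroup H] [InnerProductSpace ℂ H]
    (e : HilbertBasis ℕ ℂ H) (d : ℕ → ℂ) : H →L[ℂ] H :=
  matrixOp e (diagMatrix d)

/-- For a bounded sequence `d`, `Diag(d)` has the matrix it should have. -/
theorem hasMatrix_diagOp {H : Type*} [NormedAddCommGroup H] [InnerProductSpace ℂ H]
    (e : HilbertBasis ℕ ℂ H) (d : ℕ → ℂ) {C : ℝ} (hd : ∀ n, ‖d n‖ ≤ C) :
    HasMatrix e (diagOp e d) (diagMatrix d) := by
  have hC : 0 ≤ C := (norm_nonneg _).trans (hd 0)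
  let m : (lp (fun _ : ℕ => ℂ) 2) →L[ℂ] (lp (fun _ : ℕ => ℂ) 2) :=
    lp.mapCLM (E := fun _ : ℕ => ℂ) (F := fun _ : ℕ => ℂ) 2
      (fun i => d i • ContinuousLinearMap.id ℂ ℂ) hC
      (fun i => by simpa [norm_smul] using hd i)
  let T : H →L[ℂ] H :=
    (e.repr.symm.toContinuousLinearEquiv : lp (fun _ : ℕ => ℂ) 2 →L[ℂ] H) ∘L m ∘L
      (e.repr.toContinuousLinearEquiv : H →L[ℂ] lp (fun _ : ℕ => ℂ) 2)
  refine HasMatrix.hasMatrix_matrixOp (T := T) ?_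
  intro i j
  have h1 : T (e j) = e.repr.symm (m (e.repr (e j))) := rfl
  rw [h1, ← e.repr_apply_apply, LinearIsometryEquiv.apply_symm_apply, e.repr_self]
  have h2 : (m (lp.single 2 j (1 : ℂ))) i = d i * (lp.single (E := fun _ : ℕ => ℂ) 2 j (1 : ℂ)) i :=
    rfl
  rw [h2, lp.single_apply, diagMatrix, Pi.single_apply]
  split_ifs <;> simp

/-- A matrix with absolutely summable entries is the matrix of a bounded operator. -/
theorem exists_hasMatrix_of_summable {H : Type*} [NormedAddCommGroup H] [InnerProductSpace ℂ H]
    [CompleteSpace H] (e : HilbertBasis ℕ ℂ H) (M : ℕ → ℕ → ℂ)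
    (hM : Summable fun p : ℕ × ℕ => ‖M p.1 p.2‖) :
    ∃ T : H →L[ℂ] H, HasMatrix e T M := by
  have hs : Summable fun p : ℕ × ℕ =>
      M p.1 p.2 • InnerProductSpace.rankOne ℂ (e p.1) (e p.2) := by
    refine Summable.of_norm ?_
    refine hM.congr fun p => ?_
    rw [norm_smul, InnerProductSpace.norm_rankOne, e.orthonormal.1, e.orthonormal.1]
    simp
  refine ⟨∑' p : ℕ × ℕ, M p.1 p.2 • InnerProductSpace.rankOne ℂ (e p.1) (e p.2),
    fun i j => ?_⟩
  · have h1 := (hs.hasSum.mapL (ContinuousLinearMap.apply ℂ H (e j))).mapL (innerSL ℂ (e i))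
    have h2 : HasSum (fun p : ℕ × ℕ => (innerSL ℂ (e i)) ((ContinuousLinearMap.apply ℂ H (e j))
        (M p.1 p.2 • InnerProductSpace.rankOne ℂ (e p.1) (e p.2)))) (M i j) := by
      have hort := orthonormal_iff_ite.1 e.orthonormal
      convert hasSum_single (i, j) ?_ using 1
      · simp [e.orthonormal.1]
      · rintro ⟨k, l⟩ hkl
        simp only [ContinuousLinearMap.apply_apply, _root_.smul_apply,
          InnerProductSpace.rankOne_apply, innerSL_apply_apply, inner_smul_right, hort]
        by_cases hk : i = k
        · by_cases hl : l = j
          · exact absurd (by rw [hk, hl]) hkl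
          · simp [hl]
        · simp [hk]
    exact h1.unique h2

end MatrixOperators

/-! ### The operators `Y_r`, `D_0`, `Z_r`

The basis vectors are numbered from `0`, so that the index `n` below is the index `n + 1`
when the rows and columns are numbered from `1`. -/

section ExplicitOperators

/-- The matrix of `Y_r`: `i` times the real symmetric matrix with zero diagonal, with first row
`0, rγ, rγ², …`, and whose entry in position `(n, m)`, `n ≠ m`, `n, m ≥ 1` (numbering from `0`)
is `γ ^ (max n m - 1)`. -/
noncomputable def yMatrix (γ r : ℝ) : ℕ → ℕ → ℂ := fun n m =>
  Complex.I * ((if n = m then 0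
    else if n = 0 then r * γ ^ m
    else if m = 0 then r * γ ^ n
    else γ ^ (max n m - 1) : ℝ) : ℂ)

/-- The matrix of `Y^{[1]}`: that of `Y_r` with first row and first column replaced by zero. -/
noncomputable def yTailMatrix (γ : ℝ) : ℕ → ℕ → ℂ := fun n m =>
  Complex.I * ((if n = m ∨ n = 0 ∨ m = 0 then 0 else γ ^ (max n m - 1) : ℝ) : ℂ)

/-- The diagonal sequence `d`: it vanishes at the first index, and at the index numbered
`j = n + 1 > 1` from `1` its value is
`-(1 - γ ^ (j - 2)) / (1 - γ) - γ ^ j / (1 - γ ^ 2)`. -/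
noncomputable def dSeq (γ : ℝ) : ℕ → ℝ := fun n =>
  if n = 0 then 0
  else -((1 - γ ^ (n - 1)) / (1 - γ)) - γ ^ (n + 1) / (1 - γ ^ 2)

noncomputable def yOp {H : Type*} [NormedAddCommGroup H] [InnerProductSpace ℂ H]
    (e : HilbertBasis ℕ ℂ H) (γ r : ℝ) : H →L[ℂ] H :=
  matrixOp e (yMatrix γ r)

noncomputable def yTailOp {H : Type*} [NormedAddCommGroup H] [InnerProductSpace ℂ H]
    (e : HilbertBasis ℕ ℂ H) (γ : ℝ) : H →L[ℂ] H :=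
  matrixOp e (yTailMatrix γ)

noncomputable def dOp {H : Type*} [NormedAddCommGroup H] [InnerProductSpace ℂ H]
    (e : HilbertBasis ℕ ℂ H) (γ : ℝ) : H →L[ℂ] H :=
  diagOp e (fun n => Complex.I * (dSeq γ n : ℂ))

/-- `Z_r = Y_r + D_0`. -/
noncomputable def zOp {H : Type*} [NormedAddCommGroup H] [InnerProductSpace ℂ H]
    (e : HilbertBasis ℕ ℂ H) (γ r : ℝ) : H →L[ℂ] H :=
  yOp e γ r + dOp e γ

theorem summable_yMatrix {γ : ℝ} (r : ℝ) (h0 : γ ≠ 0) (h1 : |γ| < 1) :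
    Summable fun p : ℕ × ℕ => ‖yMatrix γ r p.1 p.2‖ := by
  set ρ : ℝ := √|γ| with hρ
  have hγ : 0 < |γ| := abs_pos.2 h0
  have hρ0 : 0 ≤ ρ := Real.sqrt_nonneg _
  have hρ1 : ρ < 1 := by
    rw [hρ, Real.sqrt_lt' one_pos]; simpa using h1
  have hsq : ρ ^ 2 = |γ| := Real.sq_sqrt hγ.le
  have hg := summable_geometric_of_lt_one hρ0 hρ1
  have hp : Summable fun p : ℕ × ℕ => ρ ^ p.1 * ρ ^ p.2 :=
    hg.mul_of_nonneg hg (fun _ => by positivity) (fun _ => by positivity)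
  refine Summable.of_nonneg_of_le (fun _ => norm_nonneg _) ?_ (hp.mul_left ((|r| + 1) / |γ|))
  have aux : ∀ k a b : ℕ, a + b ≤ 2 * k → |γ| ^ k ≤ ρ ^ a * ρ ^ b := by
    intro k a b hab
    rw [← hsq, ← pow_mul, ← pow_add]
    exact pow_le_pow_of_le_one hρ0 hρ1.le hab
  have hK1 : |r| ≤ (|r| + 1) / |γ| := by
    rw [le_div_iff₀ hγ]
    nlinarith [abs_nonneg r]
  have hK2 : 1 ≤ (|r| + 1) := by linarith [abs_nonneg r]
  rintro ⟨n, m⟩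
  have hpos : 0 ≤ ρ ^ n * ρ ^ m := by positivity
  have hK0 : 0 ≤ (|r| + 1) / |γ| := by positivity
  simp only [yMatrix, norm_mul, Complex.norm_I, one_mul, Complex.norm_real, Real.norm_eq_abs]
  split_ifs with hnm hn hm
  · simpa using mul_nonneg hK0 hpos
  · rw [abs_mul, abs_pow]
    exact mul_le_mul hK1 (aux m n m (by omega)) (by positivity) hK0
  · rw [abs_mul, abs_pow]
    exact mul_le_mul hK1 (aux n n m (by omega)) (by positivity) hK0
  · rw [abs_pow, div_mul_eq_mul_div, le_div_iff₀ hγ, ← pow_succ]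
    have := aux (max n m - 1 + 1) n m (by omega)
    nlinarith

/-- `Y_r` is a bounded operator with the stated matrix. -/
theorem hasMatrix_yOp {H : Type*} [NormedAddCommGroup H] [InnerProductSpace ℂ H]
    [CompleteSpace H] (e : HilbertBasis ℕ ℂ H) {γ : ℝ} (r : ℝ) (h0 : γ ≠ 0) (h1 : |γ| < 1) :
    HasMatrix e (yOp e γ r) (yMatrix γ r) := by
  obtain ⟨T, hT⟩ := exists_hasMatrix_of_summable e (yMatrix γ r) (summable_yMatrix r h0 h1)
  exact hT.hasMatrix_matrixOp

/-- `Y^{[1]}` is a bounded operator with the stated matrix. -/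
theorem hasMatrix_yTailOp {H : Type*} [NormedAddCommGroup H] [InnerProductSpace ℂ H]
    [CompleteSpace H] (e : HilbertBasis ℕ ℂ H) {γ : ℝ} (h0 : γ ≠ 0) (h1 : |γ| < 1) :
    HasMatrix e (yTailOp e γ) (yTailMatrix γ) := by
  have hs : Summable fun p : ℕ × ℕ => ‖yTailMatrix γ p.1 p.2‖ := by
    refine Summable.of_nonneg_of_le (fun _ => norm_nonneg _) ?_ (summable_yMatrix 0 h0 h1)
    rintro ⟨n, m⟩
    simp only [yMatrix, yTailMatrix]
    split_ifs <;> first | (exfalso; tauto) | simp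
  obtain ⟨T, hT⟩ := exists_hasMatrix_of_summable e (yTailMatrix γ) hs
  exact hT.hasMatrix_matrixOp

/-- `D_0` is a bounded diagonal operator with the stated diagonal. -/
theorem hasMatrix_dOp {H : Type*} [NormedAddCommGroup H] [InnerProductSpace ℂ H]
    (e : HilbertBasis ℕ ℂ H) {γ : ℝ} (h1 : |γ| < 1) :
    HasMatrix e (dOp e γ) (diagMatrix fun n => Complex.I * (dSeq γ n : ℂ)) := by
  have hpow : ∀ n, |γ ^ n| ≤ 1 := fun n => by
    rw [abs_pow]; exact pow_le_one₀ (abs_nonneg _) h1.le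
  refine hasMatrix_diagOp e _ (C := 2 / |1 - γ| + 1 / |1 - γ ^ 2|) fun n => ?_
  rw [norm_mul, Complex.norm_I, one_mul, Complex.norm_real, Real.norm_eq_abs, dSeq]
  split_ifs with hn
  · simp only [abs_zero]; positivity
  · refine (abs_sub _ _).trans (add_le_add ?_ ?_)
    · rw [abs_neg, abs_div]
      gcongr
      refine (abs_sub _ _).trans ?_
      have := hpow (n - 1)
      rw [abs_one]; linarith
    · rw [abs_div]
      gcongr
      exact hpow _

/-- `Z_r` is a bounded operator with the stated matrix. -/
theorem hasMatrix_zOp {H : Type*} [NormedAddCommGroup H] [InnerProductSpace ℂ H]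
    [CompleteSpace H] (e : HilbertBasis ℕ ℂ H) {γ : ℝ} (r : ℝ) (h0 : γ ≠ 0) (h1 : |γ| < 1) :
    HasMatrix e (zOp e γ r) (fun n m => Complex.I * ((if n = m then dSeq γ n
      else if n = 0 then r * γ ^ m
      else if m = 0 then r * γ ^ n
      else γ ^ (max n m - 1) : ℝ) : ℂ)) := by
  intro n m
  rw [zOp, _root_.add_apply, inner_add_right, hasMatrix_yOp e r h0 h1 n m,
    hasMatrix_dOp e h1 n m]
  simp only [yMatrix, diagMatrix]
  split_ifs <;> simp

end ExplicitOperators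

/-! ### The orbit of a compact operator under the unitary Fredholm group -/

section Orbit

/-- The unitary Fredholm group `U_c(H)`. -/
def fredholmUnitary (H : Type*) [NormedAddCommGroup H] [InnerProductSpace ℂ H]
    [CompleteSpace H] : Set (H →L[ℂ] H) :=
  {u | u ∈ unitary (H →L[ℂ] H) ∧ IsCompactOperator (u - 1 : H →L[ℂ] H)}

/-- The orbit `O_A = {u A u* : u ∈ U_c(H)}`. -/
def orbit {H : Type*} [NormedAddCommGroup H] [InnerProductSpace ℂ H] [CompleteSpace H]
    (A : H →L[ℂ] H) : Set (H →L[ℂ] H) :=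
  {c | ∃ u ∈ fredholmUnitary H, c = u * A * star u}

/-- The compact anti-Hermitian operators `K(H)^{ah}`. -/
def compactAntiHermitian (H : Type*) [NormedAddCommGroup H] [InnerProductSpace ℂ H]
    [CompleteSpace H] : Set (H →L[ℂ] H) :=
  {Y | IsCompactOperator Y ∧ star Y = -Y}

/-- The tangent space at the point `c` of an orbit: `{Yc - cY : Y ∈ K(H)^{ah}}`. -/
def tangentSpace {H : Type*} [NormedAddCommGroup H] [InnerProductSpace ℂ H] [CompleteSpace H]
    (c : H →L[ℂ] H) : Set (H →L[ℂ] H) :=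
  {x | ∃ Y ∈ compactAntiHermitian H, Y * c - c * Y = x}

/-- The Finsler norm `‖x‖_c = inf {‖Y‖ : Y ∈ K(H)^{ah}, Yc - cY = x}` of a vector `x` of the
tangent space at `c`. -/
noncomputable def finslerNorm {H : Type*} [NormedAddCommGroup H] [InnerProductSpace ℂ H]
    [CompleteSpace H] (c x : H →L[ℂ] H) : ℝ :=
  sInf {ν | ∃ Y ∈ compactAntiHermitian H, Y * c - c * Y = x ∧ ‖Y‖ = ν}

/-- `Z ∈ B(H)^{ah}` is a minimal lifting of the tangent vector `x` at `c`. -/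
def IsMinimalLifting {H : Type*} [NormedAddCommGroup H] [InnerProductSpace ℂ H]
    [CompleteSpace H] (c x Z : H →L[ℂ] H) : Prop :=
  star Z = -Z ∧ Z * c - c * Z = x ∧ ‖Z‖ = finslerNorm c x

/-- `T` is minimal: `‖T‖ ≤ ‖T + D‖` for every bounded operator `D` that is diagonal in `e`. -/
def IsMinimalOperator {H : Type*} [NormedAddCommGroup H] [InnerProductSpace ℂ H]
    (e : HilbertBasis ℕ ℂ H) (T : H →L[ℂ] H) : Prop :=
  ∀ D : H →L[ℂ] H, (∀ i j, i ≠ j → inner ℂ (e i) (D (e j)) = 0) → ‖T‖ ≤ ‖T + D‖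

/-- `β`, on the interval with end points `s` and `t` (in either order), is a `C¹` curve in the
orbit `O_A`: it takes values in `O_A` and is continuously differentiable in operator norm, with
velocities in the tangent spaces of the orbit. -/
def IsC1Curve {H : Type*} [NormedAddCommGroup H] [InnerProductSpace ℂ H] [CompleteSpace H]
    (A : H →L[ℂ] H) (β : ℝ → H →L[ℂ] H) (s t : ℝ) : Prop :=
  ∃ v : ℝ → H →L[ℂ] H, ContinuousOn v (Set.uIcc s t) ∧
    ∀ τ ∈ Set.uIcc s t, β τ ∈ orbit A ∧ HasDerivWithinAt β (v τ) (Set.uIcc s t) τ ∧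
      v τ ∈ tangentSpace (β τ)

/-- Smooth curves in the orbit `O_A`: `C¹` curves whose derivative does not vanish. -/
def IsSmoothCurve {H : Type*} [NormedAddCommGroup H] [InnerProductSpace ℂ H] [CompleteSpace H]
    (A : H →L[ℂ] H) (β : ℝ → H →L[ℂ] H) (s t : ℝ) : Prop :=
  ∃ v : ℝ → H →L[ℂ] H, ContinuousOn v (Set.uIcc s t) ∧
    ∀ τ ∈ Set.uIcc s t, β τ ∈ orbit A ∧ HasDerivWithinAt β (v τ) (Set.uIcc s t) τ ∧
      v τ ∈ tangentSpace (β τ) ∧ v τ ≠ 0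

/-- The length `∫ ‖β'(τ)‖_{β(τ)} dτ` of `β` on the interval with end points `s` and `t`,
with values in `[0, ∞]`. -/
noncomputable def curveLength {H : Type*} [NormedAddCommGroup H] [InnerProductSpace ℂ H]
    [CompleteSpace H] (β : ℝ → H →L[ℂ] H) (s t : ℝ) : ℝ≥0∞ :=
  ∫⁻ τ in Set.uIcc s t, ENNReal.ofReal (finslerNorm (β τ) (derivWithin β (Set.uIcc s t) τ))

/-- The rectifiable distance in `O_A`: the infimum of the lengths of the smooth curves in `O_A`,
on arbitrary compact intervals, that join `c₁` and `c₂`. -/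
noncomputable def rectifiableDist {H : Type*} [NormedAddCommGroup H] [InnerProductSpace ℂ H]
    [CompleteSpace H] (A c₁ c₂ : H →L[ℂ] H) : ℝ≥0∞ :=
  ⨅ (s : ℝ) (t : ℝ) (β : ℝ → H →L[ℂ] H)
    (_ : IsSmoothCurve A β s t ∧ β s = c₁ ∧ β t = c₂), curveLength β s t

/-- The curve `t ↦ e^{tZ} b e^{-tZ}`. -/
noncomputable def conjCurve {H : Type*} [NormedAddCommGroup H] [InnerProductSpace ℂ H]
    [CompleteSpace H] (Z b : H →L[ℂ] H) (t : ℝ) : H →L[ℂ] H :=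
  NormedSpace.exp (t • Z) * b * NormedSpace.exp (-(t • Z))

end Orbit

end FredholmOrbit

open scoped InnerProductSpace

namespace FredholmOrbit

/-! ### Matrix entries, diagonal operators and their commutants -/

section Basics

variable {H : Type*} [NormedAddCommGroup H] [InnerProductSpace ℂ H]

/-! Basis indices start at `0`. The numbers `dSeq γ n` are chosen so that every later column of `Z =
zOp e γ r` is orthogonal to the column `Z e₀` (`hasSum_tail_row`). Hence `Z` splits into a rank-two
block on the span of `e₀` and `Z e₀` and the block `yTailOp e γ + dOp e γ`, which kills both
vectors; the bound on `r` makes the rank-two block dominate, so `‖Z‖ = ‖Z e₀‖` (`norm_rankTwo_add`,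
`norm_zOp`).

Minimality follows by Pythagoras: `Z e₀` is orthogonal to `e₀`, so a diagonal perturbation cannot
shorten this column. If it preserves the norm, it kills `e₀`, then also `Z e₀`, and it is zero
because all other entries of `Z e₀` are nonzero (`eq_zero_of_norm_add_diagonal_eq`). As the `λ_i`
are distinct, two liftings of `x` differ by a diagonal operator, so `Z` is the only minimal lifting.
It is not compact: its diagonal tends to `-i/(1-γ)`, and adding the scalar `i/(1-γ)` gives a compact
operator. Scalars change neither commutators nor conjugations, so the curve stays in the orbit. The
Finsler norm of `x` is still `‖Z‖`, approached by compact liftings in which the scalar is replaced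
by its finite truncations (`finslerNorm_diagOp_eq`).

The lower bound for lengths compares angles. Since `Z² e₀ = -‖Z‖² e₀`, the flow rotates `e₀` in a
plane with speed `‖Z‖`. Along any competing curve `χ`, take `h = ⟨e₀, p(χ) e₀⟩` with a polynomial
`p` peaked at `λ₀` and with values in `[0, 1]` on the spectrum. Because `p(χ)' = [Y, p(χ)]` for
every lifting `Y` of `χ'`, one gets `|h'| ≤ 2‖Y‖√(h - h²)`, so the angle `θ` with `h = cos² θ` moves
no faster than the Finsler speed (`abs_re_inner_commutator_le`, `arcsin_sub_arcsin_le_lintegral`).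
As `p` tends to the indicator of `λ₀`, the length is at least the angle `|t₀|‖Z‖`
(`ofReal_angle_le_curveLength`), which is the length of `σ`. Using polynomials avoids lifting `χ` to
a curve of unitaries. -/

theorem eq_of_forall_inner_basis (e : HilbertBasis ℕ ℂ H) {v w : H}
    (h : ∀ i, ⟪e i, v⟫_ℂ = ⟪e i, w⟫_ℂ) : v = w := by
  apply e.repr.injective
  ext i
  rw [e.repr_apply_apply, e.repr_apply_apply, h i]

theorem inner_basis (e : HilbertBasis ℕ ℂ H) (i j : ℕ) :
    ⟪e i, e j⟫_ℂ = if i = j then 1 else 0 :=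
  orthonormal_iff_ite.1 e.orthonormal i j

theorem norm_basis (e : HilbertBasis ℕ ℂ H) (i : ℕ) : ‖e i‖ = 1 := e.orthonormal.1 i

/-- Parseval's identity. -/
theorem hasSum_norm_inner_sq (e : HilbertBasis ℕ ℂ H) (v : H) :
    HasSum (fun i => ‖⟪e i, v⟫_ℂ‖ ^ 2) (‖v‖ ^ 2) := by
  have h := e.hasSum_inner_mul_inner v v
  rw [inner_self_eq_norm_sq_to_K] at h
  have h2 := Complex.hasSum_re h
  convert h2 using 1
  · ext i
    rw [← inner_conj_symm v (e i), ← Complex.normSq_eq_conj_mul_self, Complex.ofReal_re,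
      Complex.normSq_eq_norm_sq]
  · norm_cast

theorem diagOp_basis (e : HilbertBasis ℕ ℂ H) {d : ℕ → ℂ} {C : ℝ} (hd : ∀ n, ‖d n‖ ≤ C)
    (j : ℕ) : diagOp e d (e j) = d j • e j := by
  refine eq_of_forall_inner_basis e fun i => ?_
  rw [hasMatrix_diagOp e d hd i j, inner_smul_right, inner_basis, diagMatrix]
  split_ifs with h
  · subst h; simp
  · simp

theorem HasMatrix.neg {e : HilbertBasis ℕ ℂ H} {T : H →L[ℂ] H} {M : ℕ → ℕ → ℂ}
    (hT : HasMatrix e T M) : HasMatrix e (-T) fun i j => -M i j := by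
  intro i j
  rw [_root_.neg_apply, inner_neg_right, hT i j]

variable [CompleteSpace H]

theorem inner_antiHermitian {Z : H →L[ℂ] H} (hZ : star Z = -Z) (v w : H) :
    ⟪v, Z w⟫_ℂ = -⟪Z v, w⟫_ℂ := by
  rw [← ContinuousLinearMap.adjoint_inner_left, ← ContinuousLinearMap.star_eq_adjoint, hZ]
  simp

theorem inner_selfAdjoint {Z : H →L[ℂ] H} (hZ : star Z = Z) (v w : H) :
    ⟪v, Z w⟫_ℂ = ⟪Z v, w⟫_ℂ := by
  rw [← ContinuousLinearMap.adjoint_inner_left, ← ContinuousLinearMap.star_eq_adjoint, hZ]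

theorem HasMatrix.star {e : HilbertBasis ℕ ℂ H} {T : H →L[ℂ] H} {M : ℕ → ℕ → ℂ}
    (hT : HasMatrix e T M) : HasMatrix e (star T) fun i j => (starRingEnd ℂ) (M j i) := by
  intro i j
  rw [ContinuousLinearMap.star_eq_adjoint, ContinuousLinearMap.adjoint_inner_right,
    ← inner_conj_symm, hT j i]

/-- `i` times a real symmetric matrix is anti-Hermitian. -/
theorem HasMatrix.star_eq_neg {e : HilbertBasis ℕ ℂ H} {T : H →L[ℂ] H} {M : ℕ → ℕ → ℂ}
    {s : ℕ → ℕ → ℝ} (hT : HasMatrix e T M) (hM : ∀ i j, M i j = Complex.I * (s i j : ℂ))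
    (hs : ∀ i j, s i j = s j i) : Star.star T = -T := by
  refine hT.star.unique ?_
  intro i j
  rw [hT.neg i j]
  simp only [hM, hs i j]
  simp

theorem inner_diagOp (e : HilbertBasis ℕ ℂ H) {d : ℕ → ℂ} {C : ℝ} (hd : ∀ n, ‖d n‖ ≤ C)
    (j : ℕ) (v : H) : ⟪e j, diagOp e d v⟫_ℂ = d j * ⟪e j, v⟫_ℂ := by
  rw [← ContinuousLinearMap.adjoint_inner_left, ← ContinuousLinearMap.star_eq_adjoint]
  have : (Star.star (diagOp e d)) (e j) = (starRingEnd ℂ) (d j) • e j := by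
    refine eq_of_forall_inner_basis e fun i => ?_
    rw [(hasMatrix_diagOp e d hd).star i j, inner_smul_right, inner_basis]
    simp only [diagMatrix]
    split_ifs with h h' h'
    · simp
    · exact absurd h.symm h'
    · exact absurd h'.symm h
    · simp
  rw [this, inner_smul_left]
  simp

/-- An operator that commutes with a diagonal operator with distinct entries is diagonal. -/
theorem inner_eq_zero_of_commute_diagOp (e : HilbertBasis ℕ ℂ H) {d : ℕ → ℂ} {C : ℝ}
    (hd : ∀ n, ‖d n‖ ≤ C) (hinj : Function.Injective d) {D : H →L[ℂ] H}
    (hD : D * diagOp e d = diagOp e d * D) {i j : ℕ} (hij : i ≠ j) : ⟪e i, D (e j)⟫_ℂ = 0 := by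
  have h1 : ⟪e i, (D * diagOp e d) (e j)⟫_ℂ = d j * ⟪e i, D (e j)⟫_ℂ := by
    rw [mul_apply_eq_comp, diagOp_basis e hd, map_smul, inner_smul_right]
  have h2 : ⟪e i, (diagOp e d * D) (e j)⟫_ℂ = d i * ⟪e i, D (e j)⟫_ℂ := by
    rw [mul_apply_eq_comp, inner_diagOp e hd]
  rw [hD, h2] at h1
  by_contra h0
  exact hij (hinj (mul_right_cancel₀ h0 h1))

theorem commute_diagOp (e : HilbertBasis ℕ ℂ H) {d : ℕ → ℂ} {C : ℝ}
    (hd : ∀ n, ‖d n‖ ≤ C) {D : H →L[ℂ] H} (hD : ∀ i j, i ≠ j → ⟪e i, D (e j)⟫_ℂ = 0) :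
    D * diagOp e d = diagOp e d * D := by
  have h1 : HasMatrix e (D * diagOp e d) fun i j => d j * ⟪e i, D (e j)⟫_ℂ := by
    intro i j
    rw [mul_apply_eq_comp, diagOp_basis e hd, map_smul, inner_smul_right]
  refine h1.unique ?_
  intro i j
  rw [mul_apply_eq_comp, inner_diagOp e hd]
  by_cases h : i = j
  · rw [h]
  · simp only [hD i j h, mul_zero]

theorem star_diagOp_ofReal (e : HilbertBasis ℕ ℂ H) {l : ℕ → ℝ} {C : ℝ} (hl : ∀ n, |l n| ≤ C) :
    Star.star (diagOp e fun n => (l n : ℂ)) = diagOp e fun n => (l n : ℂ) := by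
  have h := hasMatrix_diagOp e (fun n => (l n : ℂ)) (C := C) (fun n => by simpa using hl n)
  refine h.star.unique ?_
  intro i j
  rw [h i j]
  simp only [diagMatrix]
  split_ifs with h1 h2 h2
  · simp [h1]
  · exact absurd h1.symm h2
  · exact absurd h2.symm h1
  · simp

end Basics

/-! ### Compactness and finite sections of operators with summable matrices -/

section Compact

variable {H : Type*} [NormedAddCommGroup H] [InnerProductSpace ℂ H]

theorem isCompactOperator_rankOne (v w : H) :
    IsCompactOperator (InnerProductSpace.rankOne ℂ v w : H →L[ℂ] H) := by
  have h : IsCompactOperator (innerSL ℂ w : H →L[ℂ] ℂ) :=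
    isCompactOperator_of_locallyCompactSpace_dom (innerSL ℂ w)
  have h2 := h.clm_comp (ContinuousLinearMap.toSpanSingleton ℂ v)
  have h3 : (ContinuousLinearMap.toSpanSingleton ℂ v) ∘L (innerSL ℂ w : H →L[ℂ] ℂ) =
      InnerProductSpace.rankOne ℂ v w := by
    ext z
    simp
  rw [← h3]
  exact h2

theorem isCompactOperator_sum {ι : Type*} (s : Finset ι) (f : ι → H →L[ℂ] H)
    (hf : ∀ i ∈ s, IsCompactOperator (f i)) :
    IsCompactOperator (∑ i ∈ s, f i : H →L[ℂ] H) :=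
  (compactOperator (RingHom.id ℂ) H H).sum_mem (t := s) (f := fun i => (f i : H →L[ℂ] H)) hf

theorem not_isCompactOperator_smul_one (e : HilbertBasis ℕ ℂ H) {c : ℂ} (hc : c ≠ 0) :
    ¬ IsCompactOperator (c • (1 : H →L[ℂ] H)) := by
  intro h
  have h1 : IsCompactOperator (id : H → H) := by
    have h2 : (id : H → H) = c⁻¹ • ⇑(c • (1 : H →L[ℂ] H)) := by
      ext v
      simp [hc]
    rw [h2]
    exact h.smul (c⁻¹)
  have := (isCompactOperator_id_iff_locallyCompactSpace).1 h1
  have hfin : FiniteDimensional ℂ H := FiniteDimensional.of_locallyCompactSpace ℂ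
  exact not_finite_iff_infinite.2 inferInstance
    (e.orthonormal.linearIndependent.finite)

/-- The orthogonal projection onto the span of the first `N` basis vectors. -/
noncomputable def truncation (e : HilbertBasis ℕ ℂ H) (N : ℕ) : H →L[ℂ] H :=
  ∑ i ∈ Finset.range N, InnerProductSpace.rankOne ℂ (e i) (e i)

theorem truncation_basis (e : HilbertBasis ℕ ℂ H) (N j : ℕ) :
    truncation e N (e j) = if j < N then e j else 0 := by
  simp [truncation, inner_basis]

theorem isCompactOperator_truncation (e : HilbertBasis ℕ ℂ H) (N : ℕ) :
    IsCompactOperator (truncation e N) :=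
  isCompactOperator_sum _ _ fun _ _ => isCompactOperator_rankOne _ _

theorem truncation_mul_self (e : HilbertBasis ℕ ℂ H) (N : ℕ) :
    truncation e N * truncation e N = truncation e N := by
  have key : HasMatrix e (truncation e N) fun i j => ⟪e i, truncation e N (e j)⟫_ℂ :=
    fun i j => rfl
  refine HasMatrix.unique (e := e) ?_ key
  intro i j
  simp only [mul_apply_eq_comp, truncation_basis]
  split_ifs with h
  · rw [truncation_basis, if_pos h]
  · simp

variable [CompleteSpace H]

/-- The matrix units have norm one, so absolute summability of the entries gives convergence in
operator norm. This is the source of both compactness and approximation by finite sections. -/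
theorem hasSum_rankOne_of_hasMatrix {e : HilbertBasis ℕ ℂ H} {T : H →L[ℂ] H} {M : ℕ → ℕ → ℂ}
    (hT : HasMatrix e T M) (hM : Summable fun p : ℕ × ℕ => ‖M p.1 p.2‖) :
    HasSum (fun p : ℕ × ℕ => M p.1 p.2 • InnerProductSpace.rankOne ℂ (e p.1) (e p.2)) T := by
  have hs : Summable fun p : ℕ × ℕ =>
      M p.1 p.2 • InnerProductSpace.rankOne ℂ (e p.1) (e p.2) := by
    refine Summable.of_norm (hM.congr fun p => ?_)
    rw [norm_smul, InnerProductSpace.norm_rankOne, norm_basis, norm_basis]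
    simp
  convert hs.hasSum using 1
  refine hT.unique fun i j => ?_
  have h1 := (hs.hasSum.mapL (ContinuousLinearMap.apply ℂ H (e j))).mapL (innerSL ℂ (e i))
  refine h1.unique ?_
  convert hasSum_single (i, j) ?_ using 1
  · simp [norm_basis]
  · rintro ⟨k, l⟩ hkl
    simp only [ContinuousLinearMap.apply_apply, _root_.smul_apply,
      InnerProductSpace.rankOne_apply, innerSL_apply_apply, inner_smul_right, inner_basis]
    by_cases hk : i = k
    · by_cases hl : l = j
      · exact absurd (by rw [hk, hl]) hkl
      · simp [hl]
    · simp [hk]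

theorem isCompactOperator_of_hasMatrix {e : HilbertBasis ℕ ℂ H} {T : H →L[ℂ] H}
    {M : ℕ → ℕ → ℂ} (hT : HasMatrix e T M) (hM : Summable fun p : ℕ × ℕ => ‖M p.1 p.2‖) :
    IsCompactOperator T :=
  isCompactOperator_of_tendsto (hasSum_rankOne_of_hasMatrix hT hM) <|
    Filter.Eventually.of_forall fun s => isCompactOperator_sum s _ fun _ _ =>
      (isCompactOperator_rankOne _ _).smul _

theorem star_truncation (e : HilbertBasis ℕ ℂ H) (N : ℕ) :
    star (truncation e N) = truncation e N := by
  rw [truncation, star_sum]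
  refine Finset.sum_congr rfl fun i _ => ?_
  rw [ContinuousLinearMap.star_eq_adjoint, InnerProductSpace.adjoint_rankOne]

theorem norm_truncation_le (e : HilbertBasis ℕ ℂ H) (N : ℕ) : ‖truncation e N‖ ≤ 1 := by
  have h := CStarRing.norm_star_mul_self (x := truncation e N)
  rw [star_truncation, truncation_mul_self] at h
  nlinarith [norm_nonneg (truncation e N)]

theorem truncation_mul_rankOne_mul (e : HilbertBasis ℕ ℂ H) {N i j : ℕ} (hi : i < N)
    (hj : j < N) : truncation e N * InnerProductSpace.rankOne ℂ (e i) (e j) * truncation e N =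
      InnerProductSpace.rankOne ℂ (e i) (e j) := by
  ext v
  simp only [mul_apply_eq_comp, InnerProductSpace.rankOne_apply, map_smul,
    truncation_basis, if_pos hi]
  rw [inner_selfAdjoint (star_truncation e N), truncation_basis, if_pos hj]

/-- An operator with summable matrix is the norm limit of its finite sections. -/
theorem exists_norm_sub_truncation_lt {e : HilbertBasis ℕ ℂ H} {T : H →L[ℂ] H}
    {M : ℕ → ℕ → ℂ} (hT : HasMatrix e T M) (hM : Summable fun p : ℕ × ℕ => ‖M p.1 p.2‖)
    {ε : ℝ} (hε : 0 < ε) :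
    ∃ N, ‖T - truncation e N * T * truncation e N‖ < ε := by
  have h := hasSum_rankOne_of_hasMatrix hT hM
  obtain ⟨s, hs⟩ := (Metric.tendsto_nhds.1 h (ε / 2) (by positivity)).exists
  rw [dist_comm, dist_eq_norm] at hs
  set S := ∑ p ∈ s, M p.1 p.2 • InnerProductSpace.rankOne ℂ (e p.1) (e p.2) with hS
  obtain ⟨N, hN⟩ : ∃ N, ∀ p ∈ s, p.1 < N ∧ p.2 < N := by
    refine ⟨s.sup (fun p => p.1 + p.2) + 1, fun p hp => ?_⟩
    have := Finset.le_sup (f := fun p : ℕ × ℕ => p.1 + p.2) hp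
    omega
  refine ⟨N, ?_⟩
  have h1 : truncation e N * S * truncation e N = S := by
    rw [hS, Finset.mul_sum, Finset.sum_mul]
    refine Finset.sum_congr rfl fun p hp => ?_
    rw [mul_smul_comm, smul_mul_assoc, truncation_mul_rankOne_mul e (hN p hp).1 (hN p hp).2]
  have h2 : T - truncation e N * T * truncation e N =
      (T - S) - truncation e N * (T - S) * truncation e N := by
    rw [mul_sub, sub_mul, h1]; abel
  have h3 : ‖truncation e N * (T - S) * truncation e N‖ ≤ ‖T - S‖ := by
    have hP := norm_truncation_le e N
    calc _ ≤ ‖truncation e N‖ * ‖T - S‖ * ‖truncation e N‖ :=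
          (norm_mul_le _ _).trans (by gcongr; exact norm_mul_le _ _)
      _ ≤ 1 * ‖T - S‖ * 1 := by gcongr
      _ = _ := by ring
  rw [h2]
  linarith [norm_sub_le (T - S) (truncation e N * (T - S) * truncation e N)]

theorem add_mem_compactAntiHermitian {S T : H →L[ℂ] H} (hS : S ∈ compactAntiHermitian H)
    (hT : T ∈ compactAntiHermitian H) : S + T ∈ compactAntiHermitian H :=
  ⟨hS.1.add hT.1, by rw [star_add, hS.2, hT.2]; abel⟩

end Compact

/-! ### Norm of a rank-two block plus a smaller orthogonal block -/

section RankTwo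

variable {H : Type*} [NormedAddCommGroup H] [InnerProductSpace ℂ H]

theorem norm_add_add_sq_of_orthogonal {x y z : H} (hxy : ⟪x, y⟫_ℂ = 0) (hxz : ⟪x, z⟫_ℂ = 0)
    (hyz : ⟪y, z⟫_ℂ = 0) : ‖x + y + z‖ ^ 2 = ‖x‖ ^ 2 + ‖y‖ ^ 2 + ‖z‖ ^ 2 := by
  rw [@norm_add_sq ℂ, @norm_add_sq ℂ, inner_add_left, hxy, hxz, hyz]
  simp

variable [CompleteSpace H]

/-- The norm of an anti-Hermitian operator that splits as a rank two block, with a zero diagonal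
entry, and a block of smaller norm. -/
theorem norm_rankTwo_add {v w : H} (hv : ‖v‖ = 1) (hw : w ≠ 0) (hvw : ⟪v, w⟫_ℂ = 0)
    {R : H →L[ℂ] H} (hR : star R = -R) (hRv : R v = 0) (hRw : R w = 0) (hle : ‖R‖ ≤ ‖w‖) :
    ‖InnerProductSpace.rankOne ℂ w v - InnerProductSpace.rankOne ℂ v w + R‖ = ‖w‖ := by
  have hw0 : 0 < ‖w‖ := norm_pos_iff.2 hw
  have hwv : ⟪w, v⟫_ℂ = 0 := inner_eq_zero_symm.1 hvw
  have hvv : ⟪v, v⟫_ℂ = 1 := by rw [inner_self_eq_norm_sq_to_K, hv]; simp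
  have hww : ⟪w, w⟫_ℂ = (‖w‖ : ℂ) ^ 2 := by rw [inner_self_eq_norm_sq_to_K]; simp
  apply le_antisymm
  · refine ContinuousLinearMap.opNorm_le_bound _ hw0.le fun z => ?_
    set a := ⟪v, z⟫_ℂ with ha
    set c := ⟪w, z⟫_ℂ with hc
    -- The part of `z` orthogonal to `v` and `w`. The range of `R` is orthogonal to its kernel
    -- vectors `v`, `w`, so both `z` and its image split into three orthogonal pieces that can be
    -- compared one by one.
    set z' := z - a • v - (c / (‖w‖ : ℂ) ^ 2) • w with hz'
    have hwc : (‖w‖ : ℂ) ^ 2 ≠ 0 := by exact_mod_cast (pow_pos hw0 2).ne'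
    have hvz' : ⟪v, z'⟫_ℂ = 0 := by
      rw [hz', inner_sub_right, inner_sub_right, inner_smul_right, inner_smul_right, hvv, hvw,
        ← ha]
      ring
    have hwz' : ⟪w, z'⟫_ℂ = 0 := by
      rw [hz', inner_sub_right, inner_sub_right, inner_smul_right, inner_smul_right, hww, hwv,
        ← hc, div_mul_cancel₀ _ hwc]
      ring
    have hz : z = a • v + (c / (‖w‖ : ℂ) ^ 2) • w + z' := by rw [hz']; abel
    have hRz : R z = R z' := by
      conv_lhs => rw [hz]
      rw [map_add, map_add, map_smul, map_smul, hRv, hRw]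
      simp
    have h1 : (InnerProductSpace.rankOne ℂ w v - InnerProductSpace.rankOne ℂ v w + R) z =
        a • w + (-c) • v + R z' := by
      rw [_root_.add_apply, _root_.sub_apply, InnerProductSpace.rankOne_apply,
        InnerProductSpace.rankOne_apply, hRz, neg_smul, sub_eq_add_neg]
    have hn1 : ‖a • w + (-c) • v + R z'‖ ^ 2 =
        ‖a‖ ^ 2 * ‖w‖ ^ 2 + ‖c‖ ^ 2 + ‖R z'‖ ^ 2 := by
      rw [norm_add_add_sq_of_orthogonal, norm_smul, norm_smul, norm_neg, hv]
      · ring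
      · rw [inner_smul_left, inner_smul_right, hwv]; simp
      · rw [inner_smul_left, inner_antiHermitian hR, hRw]; simp
      · rw [inner_smul_left, inner_antiHermitian hR, hRv]; simp
    have hn2 : ‖z‖ ^ 2 = ‖a‖ ^ 2 + ‖c‖ ^ 2 / ‖w‖ ^ 2 + ‖z'‖ ^ 2 := by
      conv_lhs => rw [hz]
      rw [norm_add_add_sq_of_orthogonal, norm_smul, norm_smul, norm_div, hv]
      · simp only [norm_pow, Complex.norm_real, norm_norm]
        field_simp
      · rw [inner_smul_left, inner_smul_right, hvw]; simp
      · rw [inner_smul_left, hvz']; simp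
      · rw [inner_smul_left, hwz']; simp
    have h2 : ‖R z'‖ ≤ ‖w‖ * ‖z'‖ :=
      (R.le_opNorm z').trans (by gcongr)
    rw [h1]
    refine (sq_le_sq₀ (norm_nonneg _) (by positivity)).1 ?_
    rw [hn1, mul_pow, hn2]
    have h3 : ‖R z'‖ ^ 2 ≤ ‖w‖ ^ 2 * ‖z'‖ ^ 2 := by
      rw [← mul_pow]; gcongr
    have h4 : ‖w‖ ^ 2 * (‖a‖ ^ 2 + ‖c‖ ^ 2 / ‖w‖ ^ 2 + ‖z'‖ ^ 2) =
        ‖a‖ ^ 2 * ‖w‖ ^ 2 + ‖c‖ ^ 2 + ‖w‖ ^ 2 * ‖z'‖ ^ 2 := by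
      field_simp
    rw [h4]
    linarith
  · have h := (InnerProductSpace.rankOne ℂ w v - InnerProductSpace.rankOne ℂ v w + R).le_opNorm v
    rw [_root_.add_apply, _root_.sub_apply, InnerProductSpace.rankOne_apply,
      InnerProductSpace.rankOne_apply, hRv, hvv, hwv, hv] at h
    simpa using h

end RankTwo

/-! ### The norm of `Z_r` and its compact scalar translate -/

section Explicit

theorem summable_norm_diagMatrix {d : ℕ → ℂ} (hd : Summable fun n => ‖d n‖) :
    Summable fun p : ℕ × ℕ => ‖diagMatrix d p.1 p.2‖ := by
  have hi : Function.Injective fun n : ℕ => (n, n) := fun a b h => (Prod.mk.inj h).1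
  refine (hi.summable_iff ?_).1 ?_
  · rintro ⟨a, b⟩ hab
    have : a ≠ b := fun h => hab ⟨a, by rw [h]⟩
    simp [diagMatrix, this]
  · refine hd.congr fun n => ?_
    simp [diagMatrix]

/-- For `n ≥ 1` the sum telescopes to `γ^(n-1)/(1-γ) - γ^(n+1)/(1-γ²)`: the diagonal converges
geometrically to `-1/(1-γ)`. -/
theorem summable_dSeq_add {γ : ℝ} (h1 : |γ| < 1) :
    Summable fun n => |dSeq γ n + 1 / (1 - γ)| := by
  have hγ : 1 - γ ≠ 0 := by have := abs_lt.1 h1; linarith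
  refine Summable.abs ((summable_nat_add_iff 1).1 ?_)
  have hg := summable_geometric_of_abs_lt_one h1
  refine ((hg.mul_left (1 / (1 - γ))).sub (hg.mul_left (γ ^ 2 / (1 - γ ^ 2)))).congr fun n => ?_
  simp only [dSeq, Nat.add_eq_zero_iff, one_ne_zero, and_false, if_false, Nat.add_sub_cancel]
  rw [show n + 1 + 1 = n + 2 by ring, pow_add γ n 2]
  ring

/-- This identity is what determines `dSeq`. The entries before the diagonal contribute `γ^n
(1-γ^(n-1))/(1-γ)`, those after it `γ^(2n+1)/(1-γ²)`, and `dSeq γ n * γ^n` is the negative of their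
sum. -/
theorem hasSum_tail_row {γ : ℝ} (h1 : |γ| < 1) {n : ℕ} (hn : n ≠ 0) :
    HasSum (fun j : ℕ => (if j = n then dSeq γ n else if j = 0 then 0
      else γ ^ (max j n - 1)) * γ ^ j) 0 := by
  obtain ⟨m, rfl⟩ := Nat.exists_eq_succ_of_ne_zero hn
  have habs := abs_lt.1 h1
  have hγ1 : 1 - γ ≠ 0 := by linarith
  have hsq : γ ^ 2 < 1 := by nlinarith
  have hγ2 : 1 - γ ^ 2 ≠ 0 := by linarith
  refine (hasSum_nat_add_iff' (m + 1 + 1)).1 ?_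
  have hg := (hasSum_geometric_of_lt_one (sq_nonneg γ) hsq).mul_left (γ ^ (2 * m + 3))
  refine (congrArg (HasSum _) ?_).mpr (hg.congr_fun fun j => ?_)
  rotate_left
  · rw [if_neg (by omega), if_neg (by omega), ← pow_mul, ← pow_add, ← pow_add]
    congr 1
    have : max (j + (m + 1 + 1)) (m + 1) = j + (m + 1 + 1) := max_eq_left (by omega)
    simp only [Nat.succ_eq_add_one, this]
    omega
  · rw [Finset.sum_range_succ, Finset.sum_range_succ']
    have hs : ∀ i ∈ Finset.range m, (if i + 1 = m.succ then dSeq γ m.succ else if i + 1 = 0 then 0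
        else γ ^ (max (i + 1) m.succ - 1)) * γ ^ (i + 1) = γ ^ (m + 1) * γ ^ i := by
      intro i hi
      have hi' := Finset.mem_range.1 hi
      rw [if_neg (by omega), if_neg (by omega), max_eq_right (by omega), Nat.succ_sub_one]
      ring
    rw [Finset.sum_congr rfl hs, ← Finset.mul_sum, geom_sum_eq (by intro h; apply hγ1; linarith)]
    have hγ3 : γ - 1 ≠ 0 := by intro h; apply hγ1; linarith
    have hγ4 : (1 - γ ^ m) / (1 - γ) = (γ ^ m - 1) / (γ - 1) := by
      rw [← neg_sub (γ ^ m), ← neg_sub γ, neg_div_neg_eq]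
    simp only [dSeq, Nat.succ_eq_add_one, Nat.add_eq_zero_iff, one_ne_zero, and_false, if_false,
      Nat.add_sub_cancel, if_true]
    rw [if_neg (by omega), hγ4]
    field_simp
    ring

variable {H : Type*} [NormedAddCommGroup H] [InnerProductSpace ℂ H] [CompleteSpace H]

theorem hasMatrix_yTailOp_add_dOp (e : HilbertBasis ℕ ℂ H) {γ : ℝ} (h0 : γ ≠ 0) (h1 : |γ| < 1) :
    HasMatrix e (yTailOp e γ + dOp e γ) fun n m => Complex.I * ((if n = m then dSeq γ n
      else if n = 0 ∨ m = 0 then 0 else γ ^ (max n m - 1) : ℝ) : ℂ) := by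
  intro n m
  rw [_root_.add_apply, inner_add_right, hasMatrix_yTailOp e h0 h1 n m, hasMatrix_dOp e h1 n m]
  simp only [yTailMatrix, diagMatrix]
  by_cases h : n = m
  · simp [h]
  · simp [h]

theorem star_zOp (e : HilbertBasis ℕ ℂ H) {γ : ℝ} (r : ℝ) (h0 : γ ≠ 0) (h1 : |γ| < 1) :
    star (zOp e γ r) = -zOp e γ r := by
  refine (hasMatrix_zOp e r h0 h1).star_eq_neg (fun i j => rfl) fun i j => ?_
  rcases eq_or_ne i j with rfl | hij
  · rfl
  · simp only [if_neg hij, if_neg hij.symm, max_comm i j]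
    split_ifs with hi hj
    · exact absurd (hi.trans hj.symm) hij
    · rfl
    · rfl
    · rfl

theorem star_yTailOp_add_dOp (e : HilbertBasis ℕ ℂ H) {γ : ℝ} (h0 : γ ≠ 0) (h1 : |γ| < 1) :
    star (yTailOp e γ + dOp e γ) = -(yTailOp e γ + dOp e γ) := by
  refine (hasMatrix_yTailOp_add_dOp e h0 h1).star_eq_neg (fun i j => rfl) fun i j => ?_
  rcases eq_or_ne i j with rfl | hij
  · rfl
  · simp only [if_neg hij, if_neg hij.symm, max_comm i j, or_comm]

theorem inner_zOp_basis_zero (e : HilbertBasis ℕ ℂ H) {γ : ℝ} (r : ℝ) (h0 : γ ≠ 0)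
    (h1 : |γ| < 1) (j : ℕ) :
    ⟪e j, zOp e γ r (e 0)⟫_ℂ = if j = 0 then 0 else Complex.I * ((r * γ ^ j : ℝ) : ℂ) := by
  rw [hasMatrix_zOp e r h0 h1 j 0]
  split_ifs with h
  · simp [dSeq, h]
  · simp [h]

theorem yTailOp_add_dOp_basis_zero (e : HilbertBasis ℕ ℂ H) {γ : ℝ} (h0 : γ ≠ 0) (h1 : |γ| < 1) :
    (yTailOp e γ + dOp e γ) (e 0) = 0 := by
  refine eq_of_forall_inner_basis e fun i => ?_
  rw [hasMatrix_yTailOp_add_dOp e h0 h1 i 0]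
  by_cases h : i = 0 <;> simp [h, dSeq]

/-- The columns of `Z_r` other than the first are orthogonal to the first one. -/
theorem yTailOp_add_dOp_zOp_basis_zero (e : HilbertBasis ℕ ℂ H) {γ : ℝ} (r : ℝ) (h0 : γ ≠ 0)
    (h1 : |γ| < 1) : (yTailOp e γ + dOp e γ) (zOp e γ r (e 0)) = 0 := by
  refine eq_of_forall_inner_basis e fun n => ?_
  rw [inner_antiHermitian (star_yTailOp_add_dOp e h0 h1), inner_zero_right]
  rcases eq_or_ne n 0 with rfl | hn
  · rw [yTailOp_add_dOp_basis_zero e h0 h1]; simp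
  have hs := e.hasSum_inner_mul_inner ((yTailOp e γ + dOp e γ) (e n)) (zOp e γ r (e 0))
  have hr := (Complex.hasSum_ofReal.2 ((hasSum_tail_row h1 hn).mul_left r))
  rw [mul_zero, Complex.ofReal_zero] at hr
  rw [hs.unique (hr.congr_fun fun j => ?_), neg_zero]
  rw [← inner_conj_symm, hasMatrix_yTailOp_add_dOp e h0 h1 j n, inner_zOp_basis_zero e r h0 h1]
  rcases eq_or_ne j n with rfl | hjn
  · simp only [if_true, if_neg hn]
    push_cast
    rw [map_mul, Complex.conj_I, Complex.conj_ofReal]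
    linear_combination (-(r : ℂ) * (dSeq γ j : ℂ) * (γ : ℂ) ^ j) * Complex.I_sq
  · rcases eq_or_ne j 0 with rfl | hj
    · simp [hn.symm]
    · simp only [if_neg hjn, hj, hn, or_self, if_false]
      push_cast
      rw [map_mul, Complex.conj_I, map_pow, Complex.conj_ofReal]
      linear_combination (-(r : ℂ) * (γ : ℂ) ^ (max j n - 1) * (γ : ℂ) ^ j) * Complex.I_sq

theorem norm_zOp_basis_zero_sq (e : HilbertBasis ℕ ℂ H) {γ : ℝ} (r : ℝ) (h0 : γ ≠ 0)
    (h1 : |γ| < 1) : ‖zOp e γ r (e 0)‖ ^ 2 = r ^ 2 * ∑' k : ℕ, γ ^ (2 * (k + 1)) := by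
  have h := hasSum_norm_inner_sq e (zOp e γ r (e 0))
  have h2 := (hasSum_nat_add_iff' 1).2 h
  rw [Finset.sum_range_one, inner_zOp_basis_zero e r h0 h1 0] at h2
  simp only [inner_zOp_basis_zero e r h0 h1, Nat.add_eq_zero_iff, one_ne_zero, and_false, if_false,
    if_true, norm_mul, Complex.norm_I, Complex.norm_real, one_mul, Real.norm_eq_abs,
    norm_zero, ne_eq, OfNat.ofNat_ne_zero, not_false_eq_true, zero_pow, sub_zero] at h2
  rw [← tsum_mul_left, ← h2.tsum_eq]
  refine tsum_congr fun k => ?_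
  rw [mul_pow, sq_abs, sq_abs]
  ring

theorem tsum_pow_pos {γ : ℝ} (h0 : γ ≠ 0) (h1 : |γ| < 1) :
    0 < ∑' k : ℕ, γ ^ (2 * (k + 1)) := by
  have hsq : γ ^ 2 < 1 := by nlinarith [abs_lt.1 h1]
  have hs : Summable fun k : ℕ => γ ^ (2 * (k + 1)) := by
    refine ((summable_geometric_of_lt_one (sq_nonneg γ) hsq).mul_left (γ ^ 2)).congr fun k => ?_
    rw [pow_mul]; ring
  refine hs.tsum_pos (fun k => ?_) 0 ?_
  · rw [pow_mul]; positivity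
  · rw [pow_mul]; positivity

/-- Needed to obtain `0 < r`. The entry at `(1, 1)` is `i` times `-γ²/(1-γ²)`, which is nonzero. -/
theorem norm_yTailOp_add_dOp_pos (e : HilbertBasis ℕ ℂ H) {γ : ℝ} (h0 : γ ≠ 0) (h1 : |γ| < 1) :
    0 < ‖yTailOp e γ + dOp e γ‖ := by
  rw [norm_pos_iff]
  intro h
  have h2 := hasMatrix_yTailOp_add_dOp e h0 h1 1 1
  rw [h] at h2
  have hsq : γ ^ 2 < 1 := by nlinarith [abs_lt.1 h1]
  have h3 : dSeq γ 1 ≠ 0 := by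
    simp only [dSeq, one_ne_zero, if_false, Nat.sub_self, pow_zero, sub_self, zero_div, neg_zero,
      zero_sub]
    exact neg_ne_zero.2 (div_ne_zero (pow_ne_zero _ h0) (by linarith))
  simp at h2
  exact h3 h2

theorem r_pos (e : HilbertBasis ℕ ℂ H) {γ r : ℝ} (h0 : γ ≠ 0) (h1 : |γ| < 1)
    (hr : ‖yTailOp e γ + dOp e γ‖ / Real.sqrt (∑' k : ℕ, γ ^ (2 * (k + 1))) ≤ r) : 0 < r :=
  lt_of_lt_of_le
    (div_pos (norm_yTailOp_add_dOp_pos e h0 h1) (Real.sqrt_pos.2 (tsum_pow_pos h0 h1))) hr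

/-- The lower bound on `r` enters here: the first column has norm `r` times the square root of the
series. -/
theorem norm_yTailOp_add_dOp_le (e : HilbertBasis ℕ ℂ H) {γ r : ℝ} (h0 : γ ≠ 0) (h1 : |γ| < 1)
    (hr : ‖yTailOp e γ + dOp e γ‖ / Real.sqrt (∑' k : ℕ, γ ^ (2 * (k + 1))) ≤ r) :
    ‖yTailOp e γ + dOp e γ‖ ≤ ‖zOp e γ r (e 0)‖ := by
  have hpos := Real.sqrt_pos.2 (tsum_pow_pos h0 h1)
  have h2 : ‖zOp e γ r (e 0)‖ = r * Real.sqrt (∑' k : ℕ, γ ^ (2 * (k + 1))) := by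
    have hr0 := r_pos e h0 h1 hr
    rw [← Real.sqrt_sq (norm_nonneg (zOp e γ r (e 0))), norm_zOp_basis_zero_sq e r h0 h1,
      Real.sqrt_mul (sq_nonneg r), Real.sqrt_sq hr0.le]
  rw [h2]
  exact (div_le_iff₀ hpos).1 hr

theorem zOp_basis_zero_ne_zero (e : HilbertBasis ℕ ℂ H) {γ r : ℝ} (h0 : γ ≠ 0) (h1 : |γ| < 1)
    (hr : ‖yTailOp e γ + dOp e γ‖ / Real.sqrt (∑' k : ℕ, γ ^ (2 * (k + 1))) ≤ r) :
    zOp e γ r (e 0) ≠ 0 := by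
  rw [← norm_pos_iff]
  exact (norm_yTailOp_add_dOp_pos e h0 h1).trans_le (norm_yTailOp_add_dOp_le e h0 h1 hr)

theorem zOp_eq_rankTwo_add (e : HilbertBasis ℕ ℂ H) {γ : ℝ} (r : ℝ) (h0 : γ ≠ 0) (h1 : |γ| < 1) : zOp e γ r =
    InnerProductSpace.rankOne ℂ (zOp e γ r (e 0)) (e 0) -
      InnerProductSpace.rankOne ℂ (e 0) (zOp e γ r (e 0)) + (yTailOp e γ + dOp e γ) := by
  refine (hasMatrix_zOp e r h0 h1).unique ?_
  intro i j
  rw [_root_.add_apply, inner_add_right, hasMatrix_yTailOp_add_dOp e h0 h1 i j,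
    _root_.sub_apply, InnerProductSpace.rankOne_apply, InnerProductSpace.rankOne_apply,
    inner_sub_right, inner_smul_right, inner_smul_right, ← inner_conj_symm (zOp e γ r (e 0)) (e j),
    inner_zOp_basis_zero e r h0 h1, inner_zOp_basis_zero e r h0 h1, inner_basis, inner_basis]
  rcases eq_or_ne i j with rfl | hij
  · by_cases hi : i = 0
    · simp [hi]
    · simp [hi, Ne.symm hi]
  · by_cases hi : i = 0
    · subst hi
      simp [hij, hij.symm]
    · by_cases hj : j = 0
      · subst hj
        simp [hij]
      · simp [hi, hj, hij, Ne.symm hj]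

theorem norm_zOp (e : HilbertBasis ℕ ℂ H) {γ r : ℝ} (h0 : γ ≠ 0) (h1 : |γ| < 1)
    (hr : ‖yTailOp e γ + dOp e γ‖ / Real.sqrt (∑' k : ℕ, γ ^ (2 * (k + 1))) ≤ r) :
    ‖zOp e γ r‖ = ‖zOp e γ r (e 0)‖ := by
  conv_lhs => rw [zOp_eq_rankTwo_add e r h0 h1]
  refine norm_rankTwo_add (norm_basis e 0) (zOp_basis_zero_ne_zero e h0 h1 hr) ?_
    (star_yTailOp_add_dOp e h0 h1) (yTailOp_add_dOp_basis_zero e h0 h1)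
    (yTailOp_add_dOp_zOp_basis_zero e r h0 h1) (norm_yTailOp_add_dOp_le e h0 h1 hr)
  rw [inner_zOp_basis_zero e r h0 h1, if_pos rfl]

theorem hasMatrix_zOp_add_smul_one (e : HilbertBasis ℕ ℂ H) {γ : ℝ} (r : ℝ) (h0 : γ ≠ 0)
    (h1 : |γ| < 1) :
    HasMatrix e (zOp e γ r + (Complex.I / (1 - (γ : ℂ))) • (1 : H →L[ℂ] H)) fun n m =>
      yMatrix γ r n m +
        diagMatrix (fun k => Complex.I * ((dSeq γ k + 1 / (1 - γ) : ℝ) : ℂ)) n m := by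
  intro n m
  rw [zOp, _root_.add_apply, _root_.add_apply, inner_add_right, inner_add_right,
    hasMatrix_yOp e r h0 h1 n m, hasMatrix_dOp e h1 n m, _root_.smul_apply, one_apply_eq_self,
    inner_smul_right, inner_basis]
  simp only [diagMatrix]
  split_ifs
  · push_cast; ring
  · simp

theorem summable_yMatrix_add_diagMatrix {γ : ℝ} (r : ℝ) (h0 : γ ≠ 0) (h1 : |γ| < 1) :
    Summable fun p : ℕ × ℕ => ‖yMatrix γ r p.1 p.2 +
      diagMatrix (fun k => Complex.I * ((dSeq γ k + 1 / (1 - γ) : ℝ) : ℂ)) p.1 p.2‖ := by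
  refine Summable.of_nonneg_of_le (fun _ => norm_nonneg _) (fun p => norm_add_le _ _)
    ((summable_yMatrix r h0 h1).add (summable_norm_diagMatrix ?_))
  refine (summable_dSeq_add h1).congr fun n => ?_
  rw [norm_mul, Complex.norm_I, one_mul, Complex.norm_real, Real.norm_eq_abs]

end Explicit

/-! ### The unitary Fredholm group and conjugation by exponentials -/

section FredholmUnitary

variable {H : Type*} [NormedAddCommGroup H] [InnerProductSpace ℂ H]

theorem isCompactOperator_pow_succ {Y : H →L[ℂ] H} (hY : IsCompactOperator Y) (n : ℕ) :
    IsCompactOperator (Y ^ (n + 1)) := by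
  rw [pow_succ']
  exact hY.comp_clm (Y ^ n)

variable [CompleteSpace H]

theorem mul_mem_fredholmUnitary {u v : H →L[ℂ] H} (hu : u ∈ fredholmUnitary H)
    (hv : v ∈ fredholmUnitary H) : u * v ∈ fredholmUnitary H := by
  refine ⟨mul_mem hu.1 hv.1, ?_⟩
  have h : u * v - 1 = (u - 1) * v + (v - 1) := by noncomm_ring
  rw [h]
  exact (hu.2.comp_clm v).add hv.2

theorem star_mem_fredholmUnitary {u : H →L[ℂ] H} (hu : u ∈ fredholmUnitary H) :
    star u ∈ fredholmUnitary H := by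
  refine ⟨Unitary.star_mem hu.1, ?_⟩
  have h : Star.star u - 1 = -(Star.star u * (u - 1)) := by
    rw [mul_sub, Unitary.star_mul_self_of_mem hu.1]; noncomm_ring
  rw [h]
  exact (hu.2.clm_comp (Star.star u)).neg

theorem real_smul_mem_compactAntiHermitian {Y : H →L[ℂ] H} (hY : Y ∈ compactAntiHermitian H) (t : ℝ) :
    t • Y ∈ compactAntiHermitian H :=
  ⟨hY.1.smul t, by rw [star_smul, hY.2, star_trivial, smul_neg]⟩

theorem exp_mem_unitary {Y : H →L[ℂ] H} (hY : star Y = -Y) :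
    NormedSpace.exp Y ∈ unitary (H →L[ℂ] H) :=
  let _ : NormedAlgebra ℚ (H →L[ℂ] H) := NormedAlgebra.restrictScalars ℚ ℂ _
  NormedSpace.exp_mem_unitary_of_mem_skewAdjoint (skewAdjoint.mem_iff.2 hY)

theorem exp_mem_fredholmUnitary {Y : H →L[ℂ] H} (hY : Y ∈ compactAntiHermitian H) :
    NormedSpace.exp Y ∈ fredholmUnitary H := by
  refine ⟨exp_mem_unitary hY.2, ?_⟩
  -- Without its constant term the exponential series has compact terms and converges in norm, so
  -- `exp Y - 1` is compact.
  have h := (hasSum_nat_add_iff' 1).2 (NormedSpace.exp_series_hasSum_exp' (𝕂 := ℂ) Y)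
  rw [Finset.sum_range_one, Nat.factorial_zero, Nat.cast_one, inv_one, one_smul, pow_zero] at h
  exact isCompactOperator_of_tendsto h <| Filter.Eventually.of_forall fun s =>
    isCompactOperator_sum s _ fun n _ => (isCompactOperator_pow_succ hY.1 n).smul _

theorem star_exp {Z : H →L[ℂ] H} (hZ : star Z = -Z) :
    star (NormedSpace.exp Z) = NormedSpace.exp (-Z) := by
  rw [← hZ, NormedSpace.star_exp]

theorem star_real_smul {Z : H →L[ℂ] H} (hZ : star Z = -Z) (t : ℝ) :
    star (t • Z) = -(t • Z) := by
  rw [star_smul, hZ, star_trivial, smul_neg]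

theorem conjCurve_eq {Z : H →L[ℂ] H} (hZ : star Z = -Z) (b : H →L[ℂ] H) (t : ℝ) :
    conjCurve Z b t = NormedSpace.exp (t • Z) * b * star (NormedSpace.exp (t • Z)) := by
  rw [conjCurve, star_exp (star_real_smul hZ t)]

/-- Scalars are central, so their exponentials cancel. This lets the noncompact generator be
replaced by a compact translate without changing the curve. -/
theorem conjCurve_add_smul_one (Z b : H →L[ℂ] H) (c : ℂ) (t : ℝ) :
    conjCurve (Z + c • (1 : H →L[ℂ] H)) b t = conjCurve Z b t := by
  let _ : NormedAlgebra ℚ (H →L[ℂ] H) := NormedAlgebra.restrictScalars ℚ ℂ _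
  set k : H →L[ℂ] H := t • c • (1 : H →L[ℂ] H) with hk
  have hcomm : ∀ x : H →L[ℂ] H, Commute k x := fun x => by
    rw [hk]
    exact ((Commute.one_left x).smul_left c).smul_left t
  have h1 : NormedSpace.exp (t • (Z + c • (1 : H →L[ℂ] H))) =
      NormedSpace.exp (t • Z) * NormedSpace.exp k := by
    rw [smul_add]
    exact NormedSpace.exp_add_of_commute (hcomm _).symm
  have h2 : NormedSpace.exp (-(t • (Z + c • (1 : H →L[ℂ] H)))) =
      NormedSpace.exp (-k) * NormedSpace.exp (-(t • Z)) := by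
    rw [smul_add, neg_add_rev]
    exact NormedSpace.exp_add_of_commute ((hcomm _).neg_left.neg_right)
  have h3 : NormedSpace.exp k * NormedSpace.exp (-k) = 1 := by
    rw [← NormedSpace.exp_add_of_commute (Commute.refl k).neg_right, add_neg_cancel,
      NormedSpace.exp_zero]
  have h4 : NormedSpace.exp k * b = b * NormedSpace.exp k := ((hcomm b).symm.exp_right).symm.eq
  rw [conjCurve, conjCurve, h1, h2]
  calc _ = NormedSpace.exp (t • Z) * (NormedSpace.exp k * b) * NormedSpace.exp (-k) *
        NormedSpace.exp (-(t • Z)) := by simp only [mul_assoc]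
    _ = NormedSpace.exp (t • Z) * b * (NormedSpace.exp k * NormedSpace.exp (-k)) *
        NormedSpace.exp (-(t • Z)) := by rw [h4]; simp only [mul_assoc]
    _ = _ := by rw [h3, mul_one]

theorem conjCurve_zero (Z b : H →L[ℂ] H) : conjCurve Z b 0 = b := by
  simp [conjCurve]

theorem conjCurve_mem_orbit {A b u Z : H →L[ℂ] H} (hu : u ∈ fredholmUnitary H)
    (hA : A = u * b * star u) (hZ : Z ∈ compactAntiHermitian H) (t : ℝ) :
    conjCurve Z b t ∈ orbit A := by
  have hE := exp_mem_fredholmUnitary (real_smul_mem_compactAntiHermitian hZ t)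
  refine ⟨NormedSpace.exp (t • Z) * star u, mul_mem_fredholmUnitary hE (star_mem_fredholmUnitary hu), ?_⟩
  have h : b = star u * A * u := by
    rw [hA]
    calc b = 1 * b * 1 := by simp
      _ = star u * u * b * (star u * u) := by rw [Unitary.star_mul_self_of_mem hu.1]
      _ = _ := by simp only [mul_assoc]
  rw [conjCurve_eq hZ.2, star_mul, star_star]
  conv_lhs => rw [h]
  simp only [mul_assoc]

theorem hasDerivAt_conjCurve (Z b : H →L[ℂ] H) (t : ℝ) :
    HasDerivAt (conjCurve Z b) (Z * conjCurve Z b t - conjCurve Z b t * Z) t := by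
  have h1 := hasDerivAt_exp_smul_const' Z t
  have h2 := hasDerivAt_exp_smul_const (-Z) t
  have h3 := (h1.mul_const b).mul h2
  have h4 : (conjCurve Z b) = fun t : ℝ =>
      NormedSpace.exp (t • Z) * b * NormedSpace.exp (t • -Z) := by
    funext s
    rw [conjCurve, smul_neg]
  rw [h4]
  refine h3.congr_deriv ?_
  simp only [mul_assoc, mul_neg, sub_eq_add_neg]

end FredholmUnitary

/-! ### The Finsler norm and its unitary invariance -/

section Finsler

variable {H : Type*} [NormedAddCommGroup H] [InnerProductSpace ℂ H] [CompleteSpace H]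

theorem finslerNorm_le {c x Y : H →L[ℂ] H} (hY : Y ∈ compactAntiHermitian H)
    (hx : Y * c - c * Y = x) : finslerNorm c x ≤ ‖Y‖ :=
  csInf_le ⟨0, by rintro _ ⟨Y, -, -, rfl⟩; exact norm_nonneg _⟩ ⟨Y, hY, hx, rfl⟩

/-- Tangency makes the set of norms nonempty; otherwise the real infimum would take the default
value `0`. -/
theorem le_finslerNorm {c x : H →L[ℂ] H} (hx : x ∈ tangentSpace c) {a : ℝ}
    (h : ∀ Y ∈ compactAntiHermitian H, Y * c - c * Y = x → a ≤ ‖Y‖) : a ≤ finslerNorm c x := by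
  obtain ⟨Y, hY, hYx⟩ := hx
  refine le_csInf ⟨_, Y, hY, hYx, rfl⟩ ?_
  rintro _ ⟨Y, hY, hYx, rfl⟩
  exact h Y hY hYx

theorem conj_mem_compactAntiHermitian {u Y : H →L[ℂ] H} (hY : Y ∈ compactAntiHermitian H) :
    u * Y * star u ∈ compactAntiHermitian H :=
  ⟨(hY.1.clm_comp u).comp_clm (star u), by
    rw [star_mul, star_mul, star_star, hY.2, neg_mul, mul_neg, mul_assoc]⟩

theorem norm_unitary_conj {u : H →L[ℂ] H} (hu : u ∈ unitary (H →L[ℂ] H)) (Y : H →L[ℂ] H) :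
    ‖u * Y * star u‖ = ‖Y‖ := by
  rw [CStarRing.norm_mul_mem_unitary _ (Unitary.star_mem hu), CStarRing.norm_mem_unitary_mul _ hu]

theorem conj_commutator {u : H →L[ℂ] H} (hu : u ∈ unitary (H →L[ℂ] H)) (Y c : H →L[ℂ] H) :
    (u * Y * star u) * (u * c * star u) - (u * c * star u) * (u * Y * star u) =
      u * (Y * c - c * Y) * star u := by
  have h : ∀ S T : H →L[ℂ] H, (u * S * star u) * (u * T * star u) = u * (S * T) * star u := by
    intro S T
    calc _ = u * S * (star u * u) * T * star u := by simp only [mul_assoc]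
      _ = _ := by rw [Unitary.star_mul_self_of_mem hu]; simp only [mul_assoc, mul_one]
  rw [h, h, mul_sub, sub_mul]

theorem conj_mem_tangentSpace {u : H →L[ℂ] H} (hu : u ∈ unitary (H →L[ℂ] H)) {c x : H →L[ℂ] H}
    (hx : x ∈ tangentSpace c) : u * x * star u ∈ tangentSpace (u * c * star u) := by
  obtain ⟨Y, hY, rfl⟩ := hx
  exact ⟨_, conj_mem_compactAntiHermitian hY, conj_commutator hu Y c⟩

/-- The Finsler norm is invariant under unitary conjugation. -/
theorem finslerNorm_conj {u : H →L[ℂ] H} (hu : u ∈ unitary (H →L[ℂ] H)) {c x : H →L[ℂ] H}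
    (hx : x ∈ tangentSpace c) :
    finslerNorm (u * c * star u) (u * x * star u) = finslerNorm c x := by
  -- One inequality for all unitaries suffices; the reverse one is the same inequality for `star u`.
  have key : ∀ {v : H →L[ℂ] H}, v ∈ unitary (H →L[ℂ] H) → ∀ {d y : H →L[ℂ] H},
      y ∈ tangentSpace d → finslerNorm (v * d * star v) (v * y * star v) ≤ finslerNorm d y := by
    intro v hv d y hy
    refine le_finslerNorm hy fun Y hY hYy => ?_
    rw [← norm_unitary_conj hv Y]
    exact finslerNorm_le (conj_mem_compactAntiHermitian hY) (by rw [conj_commutator hv, hYy])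
  refine le_antisymm (key hu hx) ?_
  have h := key (Unitary.star_mem hu) (conj_mem_tangentSpace hu hx)
  have h2 : ∀ T : H →L[ℂ] H, star u * (u * T * star u) * star (star u) = T := by
    intro T
    calc _ = (star u * u) * T * (star u * u) := by simp only [mul_assoc, star_star]
      _ = T := by rw [Unitary.star_mul_self_of_mem hu]; simp
  rwa [h2, h2] at h

end Finsler

/-! ### Minimal operators and uniqueness of the minimal lifting -/

section Minimality

variable {H : Type*} [NormedAddCommGroup H] [InnerProductSpace ℂ H]

theorem apply_basis_of_diagonal (e : HilbertBasis ℕ ℂ H) {D : H →L[ℂ] H}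
    (hD : ∀ i j, i ≠ j → ⟪e i, D (e j)⟫_ℂ = 0) (j : ℕ) :
    D (e j) = ⟪e j, D (e j)⟫_ℂ • e j := by
  refine eq_of_forall_inner_basis e fun i => ?_
  rw [inner_smul_right, inner_basis]
  split_ifs with h
  · rw [h, mul_one]
  · rw [hD i j h, mul_zero]

theorem norm_add_apply_sq (e : HilbertBasis ℕ ℂ H) {Z D : H →L[ℂ] H} {j : ℕ}
    (hZ : ⟪e j, Z (e j)⟫_ℂ = 0) (hD : ∀ i j, i ≠ j → ⟪e i, D (e j)⟫_ℂ = 0) :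
    ‖(Z + D) (e j)‖ ^ 2 = ‖Z (e j)‖ ^ 2 + ‖⟪e j, D (e j)⟫_ℂ‖ ^ 2 := by
  rw [_root_.add_apply, apply_basis_of_diagonal e hD j, @norm_add_sq ℂ, inner_smul_right,
    inner_eq_zero_symm.1 hZ, norm_smul, norm_basis, mul_one]
  simp [norm_basis]

/-- A diagonal `D` adds to column `j` a vector orthogonal to it, so that column alone already forces
`‖Z + D‖ ≥ ‖Z (e j)‖`. -/
theorem isMinimalOperator_of_norm_eq (e : HilbertBasis ℕ ℂ H) {Z : H →L[ℂ] H} {j : ℕ}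
    (hZ : ⟪e j, Z (e j)⟫_ℂ = 0) (hn : ‖Z‖ = ‖Z (e j)‖) (D : H →L[ℂ] H)
    (hD : ∀ i j, i ≠ j → ⟪e i, D (e j)⟫_ℂ = 0) : ‖Z‖ ≤ ‖Z + D‖ := by
  have h := (Z + D).le_opNorm (e j)
  rw [norm_basis, mul_one] at h
  refine le_trans ?_ h
  rw [hn]
  refine (sq_le_sq₀ (norm_nonneg _) (norm_nonneg _)).1 ?_
  rw [norm_add_apply_sq e hZ hD]
  linarith [sq_nonneg ‖⟪e j, D (e j)⟫_ℂ‖]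

variable [CompleteSpace H]

/-- An anti-Hermitian operator that attains its norm at the unit vector `v` satisfies
`Z² v = -‖Z‖² v`. -/
theorem antiHermitian_sq_apply {Z : H →L[ℂ] H} (hZ : star Z = -Z) {v : H} (hv : ‖v‖ = 1)
    (hn : ‖Z v‖ = ‖Z‖) : Z (Z v) = -(((‖Z‖ : ℂ) ^ 2) • v) := by
  rw [eq_neg_iff_add_eq_zero, ← norm_eq_zero, ← sq_eq_zero_iff]
  have h1 : ‖Z (Z v)‖ ≤ ‖Z‖ ^ 2 := by
    have := Z.le_opNorm (Z v)
    rw [hn] at this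
    rwa [sq]
  have h2 : ⟪Z (Z v), v⟫_ℂ = -(‖Z‖ : ℂ) ^ 2 := by
    rw [← neg_neg ⟪Z (Z v), v⟫_ℂ, ← inner_antiHermitian hZ, inner_self_eq_norm_sq_to_K, hn]
    simp
  -- The cross term is `-2‖Z‖⁴`, so the square is at most zero once `‖Z (Z v)‖ ≤ ‖Z‖²`: the equality
  -- case of Cauchy–Schwarz.
  have h3 : ‖Z (Z v) + ((‖Z‖ : ℂ) ^ 2) • v‖ ^ 2 = ‖Z (Z v)‖ ^ 2 - ‖Z‖ ^ 4 := by
    rw [@norm_add_sq ℂ, inner_smul_right, h2, norm_smul, hv]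
    have : RCLike.re ((‖Z‖ : ℂ) ^ 2 * -(‖Z‖ : ℂ) ^ 2) = -‖Z‖ ^ 4 := by
      rw [show (‖Z‖ : ℂ) ^ 2 * -(‖Z‖ : ℂ) ^ 2 = ((-‖Z‖ ^ 4 : ℝ) : ℂ) by push_cast; ring]
      exact Complex.ofReal_re _
    rw [this]
    simp only [norm_pow, Complex.norm_real, norm_norm]
    ring
  refine le_antisymm ?_ (sq_nonneg _)
  rw [h3]
  have : ‖Z (Z v)‖ ^ 2 ≤ (‖Z‖ ^ 2) ^ 2 := by gcongr
  nlinarith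

/-- Diagonal perturbations of `Z` with the same norm vanish. -/
theorem eq_zero_of_norm_add_diagonal_eq (e : HilbertBasis ℕ ℂ H) {Z D : H →L[ℂ] H} {j : ℕ}
    (hZ : star Z = -Z) (hZj : ⟪e j, Z (e j)⟫_ℂ = 0) (hn : ‖Z‖ = ‖Z (e j)‖)
    (hne : ∀ i, i ≠ j → ⟪e i, Z (e j)⟫_ℂ ≠ 0) (hZD : star (Z + D) = -(Z + D))
    (hD : ∀ i j, i ≠ j → ⟪e i, D (e j)⟫_ℂ = 0) (hnD : ‖Z + D‖ = ‖Z‖) : D = 0 := by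
  have h1 := norm_add_apply_sq e hZj hD
  have h2 := (Z + D).le_opNorm (e j)
  rw [norm_basis, mul_one, hnD, hn] at h2
  have h3 : ‖(Z + D) (e j)‖ ^ 2 ≤ ‖Z (e j)‖ ^ 2 := by gcongr
  have h4 : ⟪e j, D (e j)⟫_ℂ = 0 := by
    rw [← norm_eq_zero, ← sq_eq_zero_iff]
    nlinarith [sq_nonneg ‖⟪e j, D (e j)⟫_ℂ‖]
  have h5 : D (e j) = 0 := by rw [apply_basis_of_diagonal e hD j, h4, zero_smul]
  have h6 : (Z + D) (e j) = Z (e j) := by rw [_root_.add_apply, h5, add_zero]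
  -- `Z + D` and `Z` agree at `e j` and both attain the common norm there. Hence their squares agree
  -- at `e j`, and subtracting leaves `D (Z (e j)) = 0`.
  have h7 := antiHermitian_sq_apply hZD (norm_basis e j) (by rw [h6, hnD, hn])
  have h8 := antiHermitian_sq_apply hZ (norm_basis e j) hn.symm
  rw [h6, hnD, ← h8, _root_.add_apply, add_eq_left] at h7
  have hDs : star D = -D := by
    have : star D = star (Z + D) - star Z := by rw [star_add]; abel
    rw [this, hZD, hZ]; abel
  refine HasMatrix.unique (e := e) (M := fun _ _ => 0) ?_ (fun i k => by simp)
  intro i k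
  rcases eq_or_ne i k with rfl | hik
  · rcases eq_or_ne i j with rfl | hij
    · exact h4
    · have h9 : ⟪e i, D (Z (e j))⟫_ℂ = 0 := by rw [h7, inner_zero_right]
      rw [inner_antiHermitian hDs, apply_basis_of_diagonal e hD i, inner_smul_left] at h9
      have h10 := (mul_eq_zero.1 (neg_eq_zero.1 h9)).resolve_right (hne i hij)
      exact (map_eq_zero _).1 h10
  · exact hD i k hik

/-- The Finsler norm of the tangent vector with lifting `Z`, for a minimal `Z` which is a
translate by a scalar of an operator with summable matrix. -/
theorem finslerNorm_diagOp_eq (e : HilbertBasis ℕ ℂ H) {l : ℕ → ℝ} {C : ℝ}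
    (hl : ∀ n, |l n| ≤ C) (hinj : Function.Injective l) {Z : H →L[ℂ] H}
    (hmin : IsMinimalOperator e Z) {c : ℂ} (hc : (starRingEnd ℂ) c = -c) {M : ℕ → ℕ → ℂ}
    (hM : HasMatrix e (Z + c • (1 : H →L[ℂ] H)) M)
    (hsum : Summable fun p : ℕ × ℕ => ‖M p.1 p.2‖)
    (hmem : Z + c • (1 : H →L[ℂ] H) ∈ compactAntiHermitian H) :
    finslerNorm (diagOp e fun n => (l n : ℂ))
      (Z * (diagOp e fun n => (l n : ℂ)) - (diagOp e fun n => (l n : ℂ)) * Z) = ‖Z‖ := by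
  have hd : ∀ n, ‖(l n : ℂ)‖ ≤ C := fun n => by simpa using hl n
  set b := diagOp e fun n => (l n : ℂ) with hb
  apply le_antisymm
  · refine le_of_forall_pos_le_add fun ε hε => ?_
    obtain ⟨N, hN⟩ := exists_norm_sub_truncation_lt hM hsum hε
    set K := Z + c • (1 : H →L[ℂ] H) with hK
    set P := truncation e N with hP
    have hPd : ∀ i j, i ≠ j → ⟪e i, (-(c • P)) (e j)⟫_ℂ = 0 := by
      intro i j hij
      rw [_root_.neg_apply, _root_.smul_apply, hP, truncation_basis]
      split_ifs <;> simp [inner_smul_right, inner_basis, hij]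
    -- `-(c • P)` is diagonal, compact and anti-Hermitian, so `K - c • P` is an admissible lifting
    -- of the same vector.
    have hPm : -(c • P) ∈ compactAntiHermitian H := by
      refine ⟨((isCompactOperator_truncation e N).smul c).neg, ?_⟩
      rw [star_neg, star_smul, star_truncation]
      change -((starRingEnd ℂ) c • P) = _
      rw [hc, neg_smul]
    have hlift : (K + -(c • P)) * b - b * (K + -(c • P)) = Z * b - b * Z := by
      rw [add_mul, mul_add, commute_diagOp e hd hPd, hK, add_mul, mul_add, smul_mul_assoc,
        mul_smul_comm, one_mul, mul_one]
      abel
    refine (finslerNorm_le (add_mem_compactAntiHermitian hmem hPm) hlift).trans ?_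
    -- Since `P K P = P Z P + c P`, the lifting is a compression of `Z` plus an error of norm below
    -- `ε`.
    have hPZP : K + -(c • P) = P * Z * P + (K - P * K * P) := by
      rw [hK, mul_add, add_mul, mul_smul_comm, smul_mul_assoc, mul_one, hP,
        truncation_mul_self]
      abel
    rw [hPZP]
    refine (norm_add_le _ _).trans (add_le_add ?_ hN.le)
    have hP1 := norm_truncation_le e N
    calc ‖P * Z * P‖ ≤ ‖P‖ * ‖Z‖ * ‖P‖ :=
          (norm_mul_le _ _).trans (by gcongr; exact norm_mul_le _ _)
      _ ≤ 1 * ‖Z‖ * 1 := by gcongr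
      _ = ‖Z‖ := by ring
  · refine le_finslerNorm ⟨_, hmem, ?_⟩ fun Y hY hYx => ?_
    · rw [add_mul, mul_add, smul_mul_assoc, mul_smul_comm, one_mul, mul_one]
      abel
    · have hcomm : (Y - Z) * b = b * (Y - Z) := by
        rw [← sub_eq_zero, sub_mul, mul_sub]
        calc _ = (Y * b - b * Y) - (Z * b - b * Z) := by abel
          _ = 0 := by rw [hYx, sub_self]
      have h := hmin (Y - Z) fun i j hij => inner_eq_zero_of_commute_diagOp e hd
        (Complex.ofReal_injective.comp hinj) hcomm hij
      rwa [add_sub_cancel] at h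

end Minimality

/-! ### Derivatives of polynomials along a curve as commutators -/

section CommutatorDeriv

variable {R : Type*} [NormedRing R] [NormedAlgebra ℝ R]

/-- `F` is continuously differentiable on `s`, with derivative `[Y, F]` for each solution `Y` of
`[Y, χ] = v`. -/
def HasCommutatorDeriv (χ v : ℝ → R) (s : Set ℝ) (F : ℝ → R) : Prop :=
  ∃ V : ℝ → R, ContinuousOn V s ∧ ∀ τ ∈ s, HasDerivWithinAt F (V τ) s τ ∧
    ∀ Y, Y * χ τ - χ τ * Y = v τ → V τ = Y * F τ - F τ * Y

namespace HasCommutatorDeriv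

variable {χ v F G : ℝ → R} {s : Set ℝ}

theorem const_one : HasCommutatorDeriv χ v s fun _ => 1 :=
  ⟨fun _ => 0, continuousOn_const, fun τ _ =>
    ⟨hasDerivWithinAt_const _ _ _, fun Y _ => by simp⟩⟩

theorem sub (hF : HasCommutatorDeriv χ v s F) (hG : HasCommutatorDeriv χ v s G) :
    HasCommutatorDeriv χ v s fun τ => F τ - G τ := by
  obtain ⟨V, hVc, hV⟩ := hF
  obtain ⟨W, hWc, hW⟩ := hG
  refine ⟨fun τ => V τ - W τ, hVc.sub hWc, fun τ hτ =>
    ⟨(hV τ hτ).1.sub (hW τ hτ).1, fun Y hY => ?_⟩⟩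
  simp only [(hV τ hτ).2 Y hY, (hW τ hτ).2 Y hY]
  noncomm_ring

theorem const_smul (a : ℝ) (hF : HasCommutatorDeriv χ v s F) :
    HasCommutatorDeriv χ v s fun τ => a • F τ := by
  obtain ⟨V, hVc, hV⟩ := hF
  refine ⟨fun τ => a • V τ, hVc.const_smul a, fun τ hτ =>
    ⟨(hV τ hτ).1.const_smul a, fun Y hY => ?_⟩⟩
  simp only [(hV τ hτ).2 Y hY, smul_sub, mul_smul_comm, smul_mul_assoc]

/-- Differentiation and `[Y, ·]` both satisfy the Leibniz rule, so polynomials in `χ` inherit the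
property. The derivative `V` is one function serving all `Y`, so no continuous choice of `Y` along
the curve is needed. -/
theorem mul (hF : HasCommutatorDeriv χ v s F) (hG : HasCommutatorDeriv χ v s G) :
    HasCommutatorDeriv χ v s fun τ => F τ * G τ := by
  obtain ⟨V, hVc, hV⟩ := hF
  obtain ⟨W, hWc, hW⟩ := hG
  have hFc : ContinuousOn F s := fun τ hτ => (hV τ hτ).1.continuousWithinAt
  have hGc : ContinuousOn G s := fun τ hτ => (hW τ hτ).1.continuousWithinAt
  refine ⟨fun τ => V τ * G τ + F τ * W τ, (hVc.mul hGc).add (hFc.mul hWc), fun τ hτ =>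
    ⟨(hV τ hτ).1.mul (hW τ hτ).1, fun Y hY => ?_⟩⟩
  simp only [(hV τ hτ).2 Y hY, (hW τ hτ).2 Y hY]
  noncomm_ring

theorem pow (hF : HasCommutatorDeriv χ v s F) (n : ℕ) :
    HasCommutatorDeriv χ v s fun τ => F τ ^ n := by
  induction n with
  | zero => simpa using const_one
  | succ n ih => simpa only [pow_succ] using ih.mul hF

end HasCommutatorDeriv

end CommutatorDeriv

/-! ### From a bound on angular speed to a bound on length -/

section LengthEstimate

/-- At `ρ = 1` this is the identity `1 - (2h - 1)² = 4(h - h²)`; a smaller `ρ` only enlarges the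
right side. -/
theorem two_mul_sqrt_le {h ρ : ℝ} (hh : h ^ 2 ≤ h) (hρ0 : 0 ≤ ρ) (hρ1 : ρ < 1) :
    2 * √(h - h ^ 2) ≤ √(1 - (ρ * (2 * h - 1)) ^ 2) := by
  apply Real.le_sqrt_of_sq_le
  rw [mul_pow, Real.sq_sqrt (by linarith), mul_pow]
  have : ρ ^ 2 ≤ 1 := by nlinarith
  nlinarith [mul_le_mul_of_nonneg_right this (sq_nonneg (2 * h - 1))]

theorem one_sub_sq_pos {h ρ : ℝ} (hh : h ^ 2 ≤ h) (hρ0 : 0 ≤ ρ) (hρ1 : ρ < 1) :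
    0 < 1 - (ρ * (2 * h - 1)) ^ 2 := by
  have h1 : (2 * h - 1) ^ 2 ≤ 1 := by nlinarith
  have h2 : ρ ^ 2 < 1 := by nlinarith
  rw [mul_pow]
  nlinarith [mul_le_mul_of_nonneg_left h1 (sq_nonneg ρ)]

/-- A function `h = cos² θ` whose angle `θ` moves with speed at most `L` changes its angle at
most by the integral of `L`. -/
theorem arcsin_sub_arcsin_le_lintegral {h h' L : ℝ → ℝ} {s t : ℝ}
    (hc : ContinuousOn h' (Set.uIcc s t))
    (hd : ∀ τ ∈ Set.uIcc s t, HasDerivWithinAt h (h' τ) (Set.uIcc s t) τ)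
    (hh : ∀ τ ∈ Set.uIcc s t, h τ ^ 2 ≤ h τ) (hL : ∀ τ ∈ Set.uIcc s t, 0 ≤ L τ)
    (hle : ∀ τ ∈ Set.uIcc s t, |h' τ| ≤ 2 * L τ * √(h τ - h τ ^ 2)) :
    ENNReal.ofReal ((Real.arcsin (2 * h s - 1) - Real.arcsin (2 * h t - 1)) / 2) ≤
      ∫⁻ τ in Set.uIcc s t, ENNReal.ofReal (L τ) := by
  -- With `h = cos² θ` and `θ ∈ [0, π/2]`, `arcsin (2h - 1) / 2 = π/4 - θ`. The factor `ρ < 1` keeps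
  -- the argument away from `±1`, where `arcsin` is not differentiable; at the end `ρ → 1`.
  have key : ∀ ρ : ℝ, 0 ≤ ρ → ρ < 1 →
      ENNReal.ofReal ((Real.arcsin (ρ * (2 * h s - 1)) - Real.arcsin (ρ * (2 * h t - 1))) / 2) ≤
        ∫⁻ τ in Set.uIcc s t, ENNReal.ofReal (L τ) := by
    intro ρ hρ0 hρ1
    set g : ℝ → ℝ := fun τ => Real.arcsin (ρ * (2 * h τ - 1)) / 2 with hg
    set g' : ℝ → ℝ := fun τ => 1 / √(1 - (ρ * (2 * h τ - 1)) ^ 2) * (ρ * (2 * h' τ)) / 2 with hg'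
    have hhc : ContinuousOn h (Set.uIcc s t) := fun τ hτ => (hd τ hτ).continuousWithinAt
    have hgd : ∀ τ ∈ Set.uIcc s t, HasDerivWithinAt g (g' τ) (Set.uIcc s t) τ := by
      intro τ hτ
      have hpos := one_sub_sq_pos (hh τ hτ) hρ0 hρ1
      have h1 := (((hd τ hτ).const_mul 2).sub_const 1).const_mul ρ
      have h2 := Real.hasDerivAt_arcsin (x := ρ * (2 * h τ - 1))
        (by intro hx; rw [hx] at hpos; norm_num at hpos)
        (by intro hx; rw [hx] at hpos; norm_num at hpos)
      exact (h2.comp_hasDerivWithinAt τ h1).div_const 2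
    have hgc : ContinuousOn g' (Set.uIcc s t) := by
      refine ((continuousOn_const.div ?_ ?_).mul (continuousOn_const.mul
        (continuousOn_const.mul hc))).div_const 2
      · exact (continuousOn_const.sub ((continuousOn_const.mul
          ((continuousOn_const.mul hhc).sub continuousOn_const)).pow 2)).sqrt
      · exact fun τ hτ => (Real.sqrt_pos.2 (one_sub_sq_pos (hh τ hτ) hρ0 hρ1)).ne'
    have hint := intervalIntegral.integral_eq_sub_of_hasDeriv_right
      (fun τ hτ => (hgd τ hτ).continuousWithinAt) (f' := g')
      (fun τ hτ => ((hgd τ ⟨hτ.1.le, hτ.2.le⟩).hasDerivAt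
        (Icc_mem_nhds hτ.1 hτ.2)).hasDerivWithinAt) hgc.intervalIntegrable
    have hgle : ∀ τ ∈ Set.uIcc s t, ‖g' τ‖ₑ ≤ ENNReal.ofReal (L τ) := by
      intro τ hτ
      rw [Real.enorm_eq_ofReal_abs]
      refine ENNReal.ofReal_le_ofReal ?_
      have hpos := Real.sqrt_pos.2 (one_sub_sq_pos (hh τ hτ) hρ0 hρ1)
      have h1 : g' τ = (ρ * h' τ) / √(1 - (ρ * (2 * h τ - 1)) ^ 2) := by
        rw [hg']; field_simp
      rw [h1, abs_div, abs_of_pos hpos, div_le_iff₀ hpos, abs_mul, abs_of_nonneg hρ0]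
      calc ρ * |h' τ| ≤ 1 * |h' τ| := by gcongr
        _ ≤ L τ * (2 * √(h τ - h τ ^ 2)) := by rw [one_mul]; linarith [hle τ hτ]
        _ ≤ _ := mul_le_mul_of_nonneg_left (two_mul_sqrt_le (hh τ hτ) hρ0 hρ1) (hL τ hτ)
    calc _ ≤ ‖∫ τ in s..t, g' τ‖ₑ := by
          rw [hint, Real.enorm_eq_ofReal_abs, abs_sub_comm]
          refine ENNReal.ofReal_le_ofReal ((le_of_eq ?_).trans (le_abs_self _))
          rw [hg]; ring
      _ = ‖∫ τ in Set.uIoc s t, g' τ‖ₑ := by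
          rw [← ofReal_norm, ← ofReal_norm,
            intervalIntegral.norm_intervalIntegral_eq]
      _ ≤ ∫⁻ τ in Set.uIoc s t, ‖g' τ‖ₑ := MeasureTheory.enorm_integral_le_lintegral_enorm _
      _ ≤ ∫⁻ τ in Set.uIcc s t, ‖g' τ‖ₑ :=
          MeasureTheory.lintegral_mono_set Set.uIoc_subset_uIcc
      _ ≤ _ := MeasureTheory.setLIntegral_mono' measurableSet_uIcc hgle
  have hlim : Filter.Tendsto (fun ρ : ℝ => ENNReal.ofReal
      ((Real.arcsin (ρ * (2 * h s - 1)) - Real.arcsin (ρ * (2 * h t - 1))) / 2)) (𝓝[<] 1)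
      (𝓝 (ENNReal.ofReal ((Real.arcsin (1 * (2 * h s - 1)) -
        Real.arcsin (1 * (2 * h t - 1))) / 2))) := by
    refine tendsto_nhdsWithin_of_tendsto_nhds (Continuous.tendsto ?_ 1)
    exact ENNReal.continuous_ofReal.comp
      (((Real.continuous_arcsin.comp (continuous_id.mul continuous_const)).sub
        (Real.continuous_arcsin.comp (continuous_id.mul continuous_const))).div_const 2)
  rw [one_mul, one_mul] at hlim
  refine le_of_tendsto hlim ?_
  filter_upwards [self_mem_nhdsWithin, nhdsWithin_le_nhds (lt_mem_nhds one_pos)] with ρ h1 h2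
  exact key ρ h2.le h1

end LengthEstimate

/-! ### Transition probabilities and the angle bound -/

section Transition

variable {H : Type*} [NormedAddCommGroup H] [InnerProductSpace ℂ H]

/-- A diagonal operator with entries in `[0, 1]`. -/
theorem hasSum_re_inner_and_norm_sq_le (e : HilbertBasis ℕ ℂ H) {Q : H →L[ℂ] H} {q : ℕ → ℝ}
    (hQ : ∀ j z, ⟪e j, Q z⟫_ℂ = (q j : ℂ) * ⟪e j, z⟫_ℂ) (hq : ∀ j, 0 ≤ q j ∧ q j ≤ 1) (z : H) :
    HasSum (fun j => q j * ‖⟪e j, z⟫_ℂ‖ ^ 2) (⟪z, Q z⟫_ℂ).re ∧ ‖Q z‖ ^ 2 ≤ (⟪z, Q z⟫_ℂ).re := by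
  have h1 : HasSum (fun j => q j * ‖⟪e j, z⟫_ℂ‖ ^ 2) (⟪z, Q z⟫_ℂ).re := by
    refine (Complex.hasSum_re (e.hasSum_inner_mul_inner z (Q z))).congr_fun fun j => ?_
    rw [hQ, ← inner_conj_symm z (e j), mul_left_comm, ← Complex.normSq_eq_conj_mul_self,
      Complex.re_ofReal_mul, Complex.ofReal_re, Complex.normSq_eq_norm_sq]
  refine ⟨h1, hasSum_le (fun j => ?_) (hasSum_norm_inner_sq e (Q z)) h1⟩
  rw [hQ, norm_mul, mul_pow, Complex.norm_real, Real.norm_eq_abs, sq_abs]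
  refine mul_le_mul_of_nonneg_right ?_ (sq_nonneg _)
  nlinarith [hq j]

variable [CompleteSpace H]

/-- The velocity of a transition probability under a commutator flow. -/
theorem abs_re_inner_commutator_le {v : H} (hv : ‖v‖ = 1) {F Y : H →L[ℂ] H} (hF : star F = F)
    (hY : star Y = -Y) {h : ℝ} (hh : h = (⟪v, F v⟫_ℂ).re) (hle : ‖F v‖ ^ 2 ≤ h) :
    |(⟪v, (Y * F - F * Y) v⟫_ℂ).re| ≤ 2 * ‖Y‖ * √(h - h ^ 2) := by
  have hvF : ⟪v, F v⟫_ℂ = (h : ℂ) := by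
    have h1 : (starRingEnd ℂ) ⟪v, F v⟫_ℂ = ⟪v, F v⟫_ℂ := by
      rw [inner_conj_symm, inner_selfAdjoint hF]
    rw [hh, Complex.conj_eq_iff_re.1 h1]
  have hvv : ⟪v, v⟫_ℂ = 1 := by rw [inner_self_eq_norm_sq_to_K, hv]; simp
  -- `g` is the component of `F v` orthogonal to `v`. Its squared norm is the variance `‖F v‖² - h²
  -- ≤ h - h²`, and only `g` contributes to the velocity because `⟨Y v, v⟩` is purely imaginary.
  set g := F v - (h : ℂ) • v with hg
  have hFg : F v = (h : ℂ) • v + g := by rw [hg]; abel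
  have hvg : ⟪v, g⟫_ℂ = 0 := by
    rw [hg, inner_sub_right, inner_smul_right, hvF, hvv]; ring
  have hgn : ‖g‖ ^ 2 = ‖F v‖ ^ 2 - h ^ 2 := by
    rw [hFg, @norm_add_sq ℂ, inner_smul_left, hvg, norm_smul, hv]
    simp
  have hgle : ‖g‖ ≤ √(h - h ^ 2) := by
    apply Real.le_sqrt_of_sq_le
    linarith
  have hYv : (⟪Y v, v⟫_ℂ).re = 0 := by
    have h1 : ⟪v, Y v⟫_ℂ = -⟪Y v, v⟫_ℂ := inner_antiHermitian hY v v
    have h2 : (⟪v, Y v⟫_ℂ).re = (⟪Y v, v⟫_ℂ).re := by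
      rw [← inner_conj_symm, Complex.conj_re]
    rw [h1, Complex.neg_re] at h2
    linarith
  have h1 : (⟪v, (Y * F - F * Y) v⟫_ℂ).re = -2 * (⟪Y v, g⟫_ℂ).re := by
    rw [_root_.sub_apply, mul_apply_eq_comp, mul_apply_eq_comp, inner_sub_right,
      inner_antiHermitian hY, inner_selfAdjoint hF v, Complex.sub_re, Complex.neg_re]
    have h2 : (⟪F v, Y v⟫_ℂ).re = (⟪Y v, F v⟫_ℂ).re := by
      rw [← inner_conj_symm, Complex.conj_re]
    have h3 : (⟪Y v, F v⟫_ℂ).re = (⟪Y v, g⟫_ℂ).re := by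
      rw [hFg, inner_add_right, inner_smul_right, Complex.add_re, Complex.re_ofReal_mul, hYv]
      ring
    rw [h2, h3]
    ring
  have h2 : |(⟪Y v, g⟫_ℂ).re| ≤ ‖Y‖ * √(h - h ^ 2) := by
    refine (Complex.abs_re_le_norm _).trans ((norm_inner_le_norm _ _).trans ?_)
    have := Y.le_opNorm v
    rw [hv, mul_one] at this
    gcongr
  rw [h1, abs_mul]
  norm_num
  linarith

/-- `(1 - m (c - a)²)ⁿ` -/
noncomputable def bump (m a : ℝ) (n : ℕ) (c : H →L[ℂ] H) : H →L[ℂ] H :=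
  (1 - m • ((c - a • (1 : H →L[ℂ] H)) * (c - a • (1 : H →L[ℂ] H)))) ^ n

theorem HasCommutatorDeriv.bump {χ v : ℝ → H →L[ℂ] H} {s : Set ℝ}
    (h : HasCommutatorDeriv χ v s χ) (m a : ℝ) (n : ℕ) :
    HasCommutatorDeriv χ v s fun τ => bump m a n (χ τ) := by
  have h1 := h.sub (const_one.const_smul a)
  exact (const_one.sub ((h1.mul h1).const_smul m)).pow n

theorem bump_conj {u : H →L[ℂ] H} (hu : u ∈ unitary (H →L[ℂ] H)) (m a : ℝ) (n : ℕ)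
    (c : H →L[ℂ] H) : bump m a n (u * c * star u) = u * bump m a n c * star u := by
  have h : ∀ x : H →L[ℂ] H, u * x * star u = Unitary.conjStarAlgAut ℝ (H →L[ℂ] H) ⟨u, hu⟩ x :=
    fun x => rfl
  rw [h, h, bump, bump]
  simp only [map_pow, map_sub, map_smul, map_mul, map_one]

theorem star_bump {c : H →L[ℂ] H} (hc : star c = c) (m a : ℝ) (n : ℕ) :
    star (bump m a n c) = bump m a n c := by
  simp [bump, hc]

theorem inner_bump_diagOp (e : HilbertBasis ℕ ℂ H) {l : ℕ → ℝ} {C : ℝ} (hl : ∀ n, |l n| ≤ C)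
    (m a : ℝ) (n j : ℕ) (z : H) : ⟪e j, bump m a n (diagOp e fun n => (l n : ℂ)) z⟫_ℂ =
      (((1 - m * (l j - a) ^ 2) ^ n : ℝ) : ℂ) * ⟪e j, z⟫_ℂ := by
  have hd : ∀ n, ‖(l n : ℂ)‖ ≤ C := fun n => by simpa using hl n
  have h1 : ∀ z, ⟪e j, ((diagOp e fun n => (l n : ℂ)) - a • (1 : H →L[ℂ] H)) z⟫_ℂ =
      ((l j - a : ℝ) : ℂ) * ⟪e j, z⟫_ℂ := by
    intro z
    rw [_root_.sub_apply, inner_sub_right, inner_diagOp e hd, _root_.smul_apply,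
      one_apply_eq_self, inner_smul_right_eq_smul, Complex.real_smul]
    push_cast; ring
  induction n generalizing z with
  | zero => simp [bump]
  | succ n ih =>
    rw [bump, pow_succ, mul_apply_eq_comp, ← bump, ih, _root_.sub_apply, inner_sub_right,
      one_apply_eq_self, _root_.smul_apply, inner_smul_right_eq_smul, Complex.real_smul,
      mul_apply_eq_comp, h1, h1]
    push_cast; ring

/-- The length of a curve in the orbit is at least the angle by which an eigenvector turns. -/
theorem ofReal_angle_le_curveLength (e : HilbertBasis ℕ ℂ H) {l : ℕ → ℝ} {C : ℝ}
    (hl : ∀ n, |l n| ≤ C) (hinj : Function.Injective l) {A u E : H →L[ℂ] H}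
    (hu : u ∈ fredholmUnitary H) (hA : A = u * (diagOp e fun n => (l n : ℂ)) * star u)
    {β : ℝ → H →L[ℂ] H} {s t : ℝ} (hβ : IsC1Curve A β s t)
    (hs : β s = diagOp e fun n => (l n : ℂ)) (hE : E ∈ unitary (H →L[ℂ] H))
    (ht : β t = E * (diagOp e fun n => (l n : ℂ)) * star E)
    {θ : ℝ} (hθ0 : 0 ≤ θ) (hθ1 : θ ≤ Real.pi / 2)
    (hθ : ‖⟪e 0, star E (e 0)⟫_ℂ‖ = Real.cos θ) :
    ENNReal.ofReal θ ≤ curveLength β s t := by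
  set b := diagOp e fun n => (l n : ℂ) with hb
  obtain ⟨v, hvc, hv⟩ := hβ
  have hC : 0 ≤ C := (abs_nonneg _).trans (hl 0)
  -- Eigenvalue differences are at most `2C`, so this scaling puts `q j` in `[0, 1]`, with value `1`
  -- only at `j = 0`. The added `1` avoids division by zero when `C = 0`.
  set m : ℝ := 1 / (2 * C + 1) ^ 2 with hm
  have hm0 : 0 < m := by positivity
  set q : ℕ → ℝ := fun j => 1 - m * (l j - l 0) ^ 2 with hq
  have hq01 : ∀ j, 0 ≤ q j ∧ q j ≤ 1 := by
    intro j
    have h1 : (l j - l 0) ^ 2 ≤ (2 * C + 1) ^ 2 := by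
      have h2 := abs_le.1 (hl j)
      have h3 := abs_le.1 (hl 0)
      exact sq_le_sq' (by linarith) (by linarith)
    have h2 : m * (l j - l 0) ^ 2 ≤ 1 := by
      rw [hm, one_div, inv_mul_le_iff₀ (by positivity), mul_one]
      exact h1
    have h3 : 0 ≤ m * (l j - l 0) ^ 2 := by positivity
    exact ⟨by simp only [hq]; linarith, by simp only [hq]; linarith⟩
  have hq1 : ∀ j, j ≠ 0 → q j < 1 := by
    intro j hj
    have h1 : 0 < (l j - l 0) ^ 2 := by
      have : l j - l 0 ≠ 0 := sub_ne_zero.2 (hinj.ne hj)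
      positivity
    simp only [hq]
    nlinarith [mul_pos hm0 h1]
  have hqn : ∀ n j, 0 ≤ q j ^ n ∧ q j ^ n ≤ 1 := fun n j =>
    ⟨pow_nonneg (hq01 j).1 n, pow_le_one₀ (hq01 j).1 (hq01 j).2⟩
  have hQ : ∀ n j z, ⟪e j, bump m (l 0) n b z⟫_ℂ = ((q j ^ n : ℝ) : ℂ) * ⟪e j, z⟫_ℂ :=
    fun n j z => inner_bump_diagOp e hl m (l 0) n j z
  -- A smoothed probability of finding `e 0` in the `λ₀`-eigenline of `β τ`; the smoothing
  -- disappears as `n → ∞`.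
  set h : ℕ → ℝ → ℝ := fun n τ => (⟪e 0, bump m (l 0) n (β τ) (e 0)⟫_ℂ).re with hh
  have hconj : ∀ {w : H →L[ℂ] H} (_ : w ∈ unitary (H →L[ℂ] H)) (n : ℕ),
      ⟪e 0, bump m (l 0) n (w * b * star w) (e 0)⟫_ℂ =
        ⟪star w (e 0), bump m (l 0) n b (star w (e 0))⟫_ℂ := by
    intro w hw n
    rw [bump_conj hw, mul_apply_eq_comp, mul_apply_eq_comp,
      ContinuousLinearMap.star_eq_adjoint, ContinuousLinearMap.adjoint_inner_left]
  -- Each point of the orbit is unitarily conjugate to `b`, so its bump has the spectrum of a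
  -- diagonal operator with entries in `[0, 1]`; this gives `F² ≤ F`.
  have hstate : ∀ n, ∀ τ ∈ Set.uIcc s t, star (bump m (l 0) n (β τ)) = bump m (l 0) n (β τ) ∧
      ‖bump m (l 0) n (β τ) (e 0)‖ ^ 2 ≤ h n τ := by
    intro n τ hτ
    obtain ⟨w, hw, hwβ⟩ := (hv τ hτ).1
    have hwu := mul_mem hw.1 hu.1
    have h1 : β τ = (w * u) * b * star (w * u) := by
      rw [hwβ, hA, star_mul]; simp only [mul_assoc]
    have hsb : star b = b := star_diagOp_ofReal e hl
    refine ⟨star_bump ?_ _ _ _, ?_⟩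
    · rw [h1]
      simp only [star_mul, star_star, hsb, mul_assoc]
    · simp only [hh]
      rw [h1, hconj hwu, bump_conj hwu]
      refine le_trans (le_of_eq ?_)
        (hasSum_re_inner_and_norm_sq_le e (hQ n) (hqn n) (star (w * u) (e 0))).2
      rw [mul_apply_eq_comp, mul_apply_eq_comp]
      congr 1
      exact ContinuousLinearMap.norm_map_of_mem_unitary hwu _
  have hsq : ∀ n, ∀ τ ∈ Set.uIcc s t, h n τ ^ 2 ≤ h n τ := by
    intro n τ hτ
    refine le_trans ?_ (hstate n τ hτ).2
    have h1 := (Complex.abs_re_le_norm _).trans (norm_inner_le_norm (𝕜 := ℂ) (e 0)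
      (bump m (l 0) n (β τ) (e 0)))
    rw [norm_basis, one_mul] at h1
    exact sq_le_sq.2 (h1.trans (le_abs_self _))
  have hlen : ∀ n, ENNReal.ofReal
      ((Real.arcsin (2 * h n s - 1) - Real.arcsin (2 * h n t - 1)) / 2) ≤
        ∫⁻ τ in Set.uIcc s t, ENNReal.ofReal (finslerNorm (β τ) (v τ)) := by
    intro n
    have hβd : HasCommutatorDeriv β v (Set.uIcc s t) β :=
      ⟨v, hvc, fun τ hτ => ⟨(hv τ hτ).2.1, fun Y hY => hY.symm⟩⟩
    obtain ⟨V, hVc, hV⟩ := hβd.bump m (l 0) n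
    have hrestr : ∀ T : H →L[ℂ] H, (⟪e 0, T (e 0)⟫_ℂ).re =
        (Complex.reCLM ∘L ((innerSL ℂ (e 0)).restrictScalars ℝ) ∘L
          ((ContinuousLinearMap.apply ℂ H (e 0)).restrictScalars ℝ)) T := fun T => rfl
    refine arcsin_sub_arcsin_le_lintegral (h' := fun τ => (⟪e 0, V τ (e 0)⟫_ℂ).re) ?_ ?_
      (hsq n) ?_ ?_
    · simp only [hrestr]
      exact (ContinuousLinearMap.continuous _).comp_continuousOn hVc
    · intro τ hτ
      simp only [hh, hrestr]
      exact (ContinuousLinearMap.hasFDerivAt _).comp_hasDerivWithinAt τ (hV τ hτ).1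
    · exact fun τ hτ => le_finslerNorm (hv τ hτ).2.2 fun Y _ _ => norm_nonneg _
    · intro τ hτ
      have hstep : ∀ Y ∈ compactAntiHermitian H, Y * β τ - β τ * Y = v τ →
          |(⟪e 0, V τ (e 0)⟫_ℂ).re| ≤ 2 * ‖Y‖ * √(h n τ - h n τ ^ 2) := by
        intro Y hY hYv
        rw [(hV τ hτ).2 Y hYv]
        exact abs_re_inner_commutator_le (norm_basis e 0) (hstate n τ hτ).1 hY.2 rfl
          (hstate n τ hτ).2
      -- To pass to the infimum over liftings `Y`, divide by the root when it is positive. When it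
      -- vanishes, a single lifting already shows that the derivative is zero.
      rcases (Real.sqrt_nonneg (h n τ - h n τ ^ 2)).eq_or_lt with h0 | h0
      · obtain ⟨Y, hY, hYv⟩ := (hv τ hτ).2.2
        have := hstep Y hY hYv
        rw [← h0, mul_zero] at this ⊢
        exact this
      · have h1 : |(⟪e 0, V τ (e 0)⟫_ℂ).re| / (2 * √(h n τ - h n τ ^ 2)) ≤
            finslerNorm (β τ) (v τ) := by
          refine le_finslerNorm (hv τ hτ).2.2 fun Y hY hYv => ?_
          rw [div_le_iff₀ (by positivity)]
          linarith [hstep Y hY hYv]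
        rw [div_le_iff₀ (by positivity)] at h1
        linarith
  have hcl : curveLength β s t =
      ∫⁻ τ in Set.uIcc s t, ENNReal.ofReal (finslerNorm (β τ) (v τ)) := by
    rw [curveLength]
    -- On a degenerate interval `derivWithin` need not equal `v`, but both integrals are over a null
    -- set.
    rcases eq_or_ne s t with rfl | hst
    · simp
    · refine MeasureTheory.setLIntegral_congr_fun measurableSet_uIcc fun τ hτ => ?_
      rw [(hv τ hτ).2.1.derivWithin (uniqueDiffOn_Icc (inf_lt_sup.2 hst) τ hτ)]
  have hhs : ∀ n, h n s = 1 := by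
    intro n
    simp only [hh]
    rw [hs, hQ, inner_basis]
    simp [hq]
  -- The powers `q j ^ n` tend to the indicator of `j = 0`; Parseval's series dominates.
  have hht : Filter.Tendsto (fun n => h n t) Filter.atTop (𝓝 (Real.cos θ ^ 2)) := by
    have h1 : ∀ n, h n t = ∑' j, q j ^ n * ‖⟪e j, star E (e 0)⟫_ℂ‖ ^ 2 := by
      intro n
      simp only [hh]
      rw [ht, hconj hE]
      exact (hasSum_re_inner_and_norm_sq_le e (hQ n) (hqn n) _).1.tsum_eq.symm
    have h2 : Real.cos θ ^ 2 =
        ∑' j, if j = 0 then ‖⟪e 0, star E (e 0)⟫_ℂ‖ ^ 2 else 0 := by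
      rw [tsum_ite_eq, hθ]
    simp only [h1]
    rw [h2]
    refine tendsto_tsum_of_dominated_convergence (hasSum_norm_inner_sq e (star E (e 0))).summable
      (fun j => ?_) (Filter.Eventually.of_forall fun n j => ?_)
    · split_ifs with hj
      · subst hj
        simp [hq]
      · simpa using (tendsto_pow_atTop_nhds_zero_of_lt_one (hq01 j).1 (hq1 j hj)).mul_const
          (‖⟪e j, star E (e 0)⟫_ℂ‖ ^ 2)
    · rw [Real.norm_eq_abs, abs_of_nonneg (mul_nonneg (hqn n j).1 (sq_nonneg _))]
      exact mul_le_of_le_one_left (sq_nonneg _) (hqn n j).2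
  rw [hcl]
  have hlim : Filter.Tendsto (fun n => ENNReal.ofReal
      ((Real.arcsin (2 * h n s - 1) - Real.arcsin (2 * h n t - 1)) / 2)) Filter.atTop
      (𝓝 (ENNReal.ofReal ((Real.pi / 2 - Real.arcsin (2 * Real.cos θ ^ 2 - 1)) / 2))) := by
    refine ENNReal.tendsto_ofReal ?_
    have h1 : ∀ n, Real.arcsin (2 * h n s - 1) = Real.pi / 2 := by
      intro n
      rw [hhs, show (2 * 1 - 1 : ℝ) = 1 by norm_num, Real.arcsin_one]
    simp only [h1]
    exact (((Real.continuous_arcsin.tendsto _).comp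
      ((hht.const_mul 2).sub_const 1)).const_sub _).div_const 2
  have hval : (Real.pi / 2 - Real.arcsin (2 * Real.cos θ ^ 2 - 1)) / 2 = θ := by
    rw [← Real.cos_two_mul, ← Real.sin_pi_div_two_sub, Real.arcsin_sin (by linarith)
      (by linarith)]
    ring
  rw [hval] at hlim
  exact le_of_tendsto' hlim hlen

/-- The action of the one-parameter group of an anti-Hermitian operator on a unit vector where
its norm is attained. -/
theorem exp_neg_smul_apply {Z : H →L[ℂ] H} {v : H} (hZ0 : Z ≠ 0)
    (hZv : Z (Z v) = -(((‖Z‖ : ℂ) ^ 2) • v)) (t : ℝ) :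
    NormedSpace.exp (-(t • Z)) v =
      (Real.cos (t * ‖Z‖) : ℂ) • v - ((Real.sin (t * ‖Z‖) / ‖Z‖ : ℝ) : ℂ) • Z v := by
  let _ : NormedAlgebra ℚ (H →L[ℂ] H) := NormedAlgebra.restrictScalars ℚ ℂ _
  have hn : ‖Z‖ ≠ 0 := norm_ne_zero_iff.2 hZ0
  -- The candidate rotation satisfies `g' = -Z g`, so `exp (t • Z) (g t)` is constant and equal to
  -- `v`.
  set g : ℝ → H := fun t => Real.cos (t * ‖Z‖) • v - (Real.sin (t * ‖Z‖) / ‖Z‖) • Z v with hg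
  have hgd : ∀ t, HasDerivAt g ((-Real.sin (t * ‖Z‖) * ‖Z‖) • v - Real.cos (t * ‖Z‖) • Z v) t := by
    intro t
    have h0 : HasDerivAt (fun t : ℝ => t * ‖Z‖) ‖Z‖ t := by
      simpa using (hasDerivAt_id t).mul_const ‖Z‖
    have h1 := (h0.cos).smul_const v
    have h2 := ((h0.sin).div_const ‖Z‖).smul_const (Z v)
    rw [mul_div_cancel_right₀ _ hn] at h2
    exact h1.sub h2
  have hZg : ∀ t, Z (g t) = Real.cos (t * ‖Z‖) • Z v + (Real.sin (t * ‖Z‖) * ‖Z‖) • v := by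
    intro t
    simp only [hg]
    rw [map_sub, Z.map_smul_of_tower, Z.map_smul_of_tower, hZv, smul_neg, sub_neg_eq_add]
    congr 1
    rw [← Complex.coe_smul, ← Complex.coe_smul, smul_smul]
    congr 1
    push_cast
    have : (‖Z‖ : ℂ) ≠ 0 := by exact_mod_cast hn
    field_simp
  have hEd : ∀ t : ℝ, HasDerivAt (fun t : ℝ => NormedSpace.exp (t • Z) (g t)) 0 t := by
    intro t
    have h1 := hasDerivAt_exp_smul_const Z t
    have h2 := ((ContinuousLinearMap.restrictScalarsL ℂ H H ℝ ℝ).hasFDerivAt).comp_hasDerivAt t h1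
    have h3 := h2.clm_apply (hgd t)
    refine h3.congr_deriv ?_
    change (NormedSpace.exp (t • Z) * Z) (g t) + NormedSpace.exp (t • Z) _ = 0
    rw [mul_apply_eq_comp, hZg, ← map_add]
    convert map_zero (NormedSpace.exp (t • Z)) using 2
    rw [neg_mul, neg_smul]
    abel
  have hconst := is_const_of_deriv_eq_zero (fun t => (hEd t).differentiableAt)
    (fun t => (hEd t).deriv) t 0
  have hg0 : g 0 = v := by simp [hg]
  rw [hg0, zero_smul, NormedSpace.exp_zero, one_apply_eq_self] at hconst
  have hinv : NormedSpace.exp (-(t • Z)) * NormedSpace.exp (t • Z) = 1 := by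
    rw [← NormedSpace.exp_add_of_commute (Commute.refl _).neg_left, neg_add_cancel,
      NormedSpace.exp_zero]
  have h1 : NormedSpace.exp (-(t • Z)) (NormedSpace.exp (t • Z) (g t)) = g t := by
    rw [← mul_apply_eq_comp, hinv, one_apply_eq_self]
  rw [hconst] at h1
  rw [h1, hg]
  simp only [Complex.coe_smul]

end Transition

/-! ### The curve `e^{tZ} b e^{-tZ}` and its constant speed -/

section Geodesic

variable {H : Type*} [NormedAddCommGroup H] [InnerProductSpace ℂ H] [CompleteSpace H]

theorem IsSmoothCurve.isC1Curve {A : H →L[ℂ] H} {β : ℝ → H →L[ℂ] H} {s t : ℝ}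
    (h : IsSmoothCurve A β s t) : IsC1Curve A β s t := by
  obtain ⟨v, hc, hv⟩ := h
  exact ⟨v, hc, fun τ hτ => ⟨(hv τ hτ).1, (hv τ hτ).2.1, (hv τ hτ).2.2.1⟩⟩

/-- The velocity of `e^{tZ} b e^{-tZ}` is the conjugate of the initial velocity. -/
theorem commutator_conjCurve {Z : H →L[ℂ] H} (hZ : star Z = -Z) (b : H →L[ℂ] H) (t : ℝ) :
    Z * conjCurve Z b t - conjCurve Z b t * Z =
      NormedSpace.exp (t • Z) * (Z * b - b * Z) * star (NormedSpace.exp (t • Z)) := by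
  have hE := exp_mem_unitary (star_real_smul hZ t)
  have hcomm : Commute Z (NormedSpace.exp (t • Z)) := ((Commute.refl Z).smul_right t).exp_right
  have hZc : NormedSpace.exp (t • Z) * Z * star (NormedSpace.exp (t • Z)) = Z := by
    rw [← hcomm.eq, mul_assoc, Unitary.mul_star_self_of_mem hE, mul_one]
  rw [← conj_commutator hE, hZc, conjCurve_eq hZ]

theorem isSmoothCurve_conjCurve {A b u Z : H →L[ℂ] H} (hu : u ∈ fredholmUnitary H)
    (hA : A = u * b * star u) (hZ : star Z = -Z) {c : ℂ}
    (hZc : Z + c • (1 : H →L[ℂ] H) ∈ compactAntiHermitian H) (hx : Z * b - b * Z ≠ 0) (s t : ℝ) :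
    IsSmoothCurve A (conjCurve Z b) s t := by
  have hd : ∀ τ, HasDerivAt (conjCurve Z b) (Z * conjCurve Z b τ - conjCurve Z b τ * Z) τ :=
    fun τ => hasDerivAt_conjCurve Z b τ
  have hcont : Continuous (conjCurve Z b) :=
    continuous_iff_continuousAt.2 fun τ => (hd τ).continuousAt
  refine ⟨fun τ => Z * conjCurve Z b τ - conjCurve Z b τ * Z,
    ((continuous_const.mul hcont).sub (hcont.mul continuous_const)).continuousOn,
    fun τ _ => ⟨?_, (hd τ).hasDerivWithinAt, ⟨_, hZc, ?_⟩, ?_⟩⟩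
  · rw [← conjCurve_add_smul_one Z b c τ]
    exact conjCurve_mem_orbit hu hA hZc τ
  · simp only [add_mul, mul_add, smul_mul_assoc, mul_smul_comm, one_mul, mul_one]
    abel
  · simp only [commutator_conjCurve hZ]
    rw [← norm_ne_zero_iff, norm_unitary_conj (exp_mem_unitary (star_real_smul hZ τ)),
      norm_ne_zero_iff]
    exact hx

/-- The velocity is carried along by unitary conjugation, so the Finsler speed is constant.
Invariance holds for every unitary, so `exp (t • Z)` need not lie in the Fredholm group. -/
theorem curveLength_conjCurve {b Z : H →L[ℂ] H} (hZ : star Z = -Z)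
    (hx : Z * b - b * Z ∈ tangentSpace b) (t : ℝ) : curveLength (conjCurve Z b) 0 t =
      ENNReal.ofReal (|t| * finslerNorm b (Z * b - b * Z)) := by
  rcases eq_or_ne 0 t with rfl | ht
  · simp [curveLength]
  have hconst : ∀ τ ∈ Set.uIcc 0 t, ENNReal.ofReal (finslerNorm (conjCurve Z b τ)
      (derivWithin (conjCurve Z b) (Set.uIcc 0 t) τ)) =
        ENNReal.ofReal (finslerNorm b (Z * b - b * Z)) := by
    intro τ hτ
    have hu : UniqueDiffWithinAt ℝ (Set.uIcc 0 t) τ := uniqueDiffOn_Icc (inf_lt_sup.2 ht) τ hτ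
    rw [(hasDerivAt_conjCurve Z b τ).hasDerivWithinAt.derivWithin hu, commutator_conjCurve hZ, conjCurve_eq hZ,
      finslerNorm_conj (exp_mem_unitary (star_real_smul hZ τ)) hx]
  rw [curveLength, MeasureTheory.setLIntegral_congr_fun measurableSet_uIcc hconst,
    MeasureTheory.setLIntegral_const, Real.volume_interval, sub_zero,
    ENNReal.ofReal_mul (abs_nonneg t), mul_comm]

end Geodesic

end FredholmOrbit

/-! ### Assembly of the theorem -/

open FredholmOrbit

theorem mainTheorem1 {H : Type*} [NormedAddCommGroup H] [InnerProductSpace ℂ H]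
    [CompleteSpace H] (e : HilbertBasis ℕ ℂ H)
    (lam : ℕ → ℝ) (hbdd : ∃ C : ℝ, ∀ n, |lam n| ≤ C) (hlam : Function.Injective lam)
    (A b u : H →L[ℂ] H) (hb : b = FredholmOrbit.diagOp e (fun n => (lam n : ℂ)))
    (hu : u ∈ FredholmOrbit.fredholmUnitary H) (hA : A = u * b * star u)
    (hAc : IsCompactOperator A)
    (γ r : ℝ) (hγ0 : γ ≠ 0) (hγ1 : |γ| < 1)
    (hr : ‖FredholmOrbit.yTailOp e γ + FredholmOrbit.dOp e γ‖ /
      Real.sqrt (∑' k : ℕ, γ ^ (2 * (k + 1))) ≤ r)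
    (Y Z Zα x : H →L[ℂ] H) (σ : ℝ → H →L[ℂ] H)
    (hY : Y = FredholmOrbit.yOp e γ r) (hZ : Z = FredholmOrbit.zOp e γ r)
    (hZα : Zα = Z + (Complex.I / (1 - (γ : ℂ))) • (1 : H →L[ℂ] H))
    (hx : x = Z * b - b * Z) (hσ : σ = FredholmOrbit.conjCurve Z b) :
    -- the operator `Z_r` is anti-Hermitian, minimal, and not compact
    (star Z = -Z ∧ FredholmOrbit.IsMinimalOperator e Z ∧ ¬ IsCompactOperator Z) ∧
    -- the curve in terms of the compact operator `Z_r + (i / (1 - γ)) I`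
    (Zα ∈ FredholmOrbit.compactAntiHermitian H ∧
      ∀ t : ℝ, NormedSpace.exp (t • Zα) ∈ FredholmOrbit.fredholmUnitary H ∧
        σ t = FredholmOrbit.conjCurve Zα b t ∧ σ t ∈ FredholmOrbit.orbit A) ∧
    -- the initial velocity
    (HasDerivAt σ x 0 ∧ x = Y * b - b * Y ∧ x ∈ FredholmOrbit.tangentSpace b) ∧
    -- minimality and length
    (∀ t₀ : ℝ, |t₀| ≤ Real.pi / (2 * ‖Z‖) →
      FredholmOrbit.IsSmoothCurve A σ 0 t₀ ∧
      (∀ χ : ℝ → H →L[ℂ] H, FredholmOrbit.IsC1Curve A χ 0 t₀ → χ 0 = b → χ t₀ = σ t₀ →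
        FredholmOrbit.curveLength σ 0 t₀ ≤ FredholmOrbit.curveLength χ 0 t₀) ∧
      FredholmOrbit.curveLength σ 0 t₀ =
        (⨅ (χ : ℝ → H →L[ℂ] H)
          (_ : FredholmOrbit.IsSmoothCurve A χ 0 t₀ ∧ χ 0 = b ∧ χ t₀ = σ t₀),
          FredholmOrbit.curveLength χ 0 t₀) ∧
      FredholmOrbit.curveLength σ 0 t₀ = FredholmOrbit.rectifiableDist A b (σ t₀) ∧
      FredholmOrbit.curveLength σ 0 t₀ =
        ENNReal.ofReal (|t₀| * FredholmOrbit.finslerNorm b x)) ∧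
    -- `Z_r` is a minimal lifting of `x`, and no minimal lifting of `x` is compact
    (FredholmOrbit.IsMinimalLifting b x Z ∧
      ¬ ∃ Z' : H →L[ℂ] H, FredholmOrbit.IsMinimalLifting b x Z' ∧ IsCompactOperator Z') := by
  obtain ⟨C, hC⟩ := hbdd
  have hd : ∀ n, ‖(lam n : ℂ)‖ ≤ C := fun n => by simpa using hC n
  have hinj : Function.Injective fun n => (lam n : ℂ) := Complex.ofReal_injective.comp hlam
  have hZs : star Z = -Z := hZ ▸ star_zOp e r hγ0 hγ1
  have hcol : ∀ j, inner ℂ (e j) (Z (e 0)) =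
      if j = 0 then 0 else Complex.I * ((r * γ ^ j : ℝ) : ℂ) :=
    fun j => hZ ▸ inner_zOp_basis_zero e r hγ0 hγ1 j
  have hnorm : ‖Z‖ = ‖Z (e 0)‖ := hZ ▸ norm_zOp e hγ0 hγ1 hr
  have hr0 : 0 < r := r_pos e hγ0 hγ1 hr
  have hcol0 : inner ℂ (e 0) (Z (e 0)) = 0 := by rw [hcol, if_pos rfl]
  have hcolne : ∀ j, j ≠ 0 → inner ℂ (e j) (Z (e 0)) ≠ 0 := by
    intro j hj
    rw [hcol, if_neg hj]
    exact mul_ne_zero Complex.I_ne_zero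
      (Complex.ofReal_ne_zero.2 (mul_ne_zero hr0.ne' (pow_ne_zero _ hγ0)))
  have hmin : IsMinimalOperator e Z := fun D hD => isMinimalOperator_of_norm_eq e hcol0 hnorm D hD
  have hZ0 : Z ≠ 0 := by
    rintro h
    exact hcolne 1 one_ne_zero (by rw [h]; simp)
  -- `c` cancels the limit `-i/(1-γ)` of the diagonal of `Z`; being purely imaginary, it preserves
  -- anti-Hermitian operators.
  set c : ℂ := Complex.I / (1 - (γ : ℂ)) with hc
  have hcr : c = Complex.I * ((1 / (1 - γ) : ℝ) : ℂ) := by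
    rw [hc]; push_cast; ring
  have hγ1' : 1 - γ ≠ 0 := by have := abs_lt.1 hγ1; linarith
  have hc0 : c ≠ 0 := by
    rw [hcr]
    exact mul_ne_zero Complex.I_ne_zero (Complex.ofReal_ne_zero.2 (one_div_ne_zero hγ1'))
  have hcs : (starRingEnd ℂ) c = -c := by
    rw [hcr, map_mul, Complex.conj_I, Complex.conj_ofReal, neg_mul]
  have hM := hasMatrix_zOp_add_smul_one e r hγ0 hγ1
  rw [← hZ, ← hc] at hM
  have hsum := summable_yMatrix_add_diagMatrix r hγ0 hγ1
  have hZc : Z + c • (1 : H →L[ℂ] H) ∈ compactAntiHermitian H := by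
    refine ⟨isCompactOperator_of_hasMatrix hM hsum, ?_⟩
    rw [star_add, star_smul, star_one, hZs, neg_add]
    change -Z + (starRingEnd ℂ) c • (1 : H →L[ℂ] H) = _
    rw [hcs, neg_smul]
  -- Otherwise the nonzero scalar `c • 1` would be a difference of compact operators on an
  -- infinite-dimensional space.
  have hZnc : ¬ IsCompactOperator Z := by
    intro h
    refine not_isCompactOperator_smul_one e hc0 ?_
    have h2 := hZc.1.sub h
    rwa [← FunLike.coe_sub, add_sub_cancel_left] at h2
  have hσd : HasDerivAt σ x 0 := by
    have h := hasDerivAt_conjCurve Z b 0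
    rwa [conjCurve_zero, ← hσ, ← hx] at h
  have hxT : x ∈ tangentSpace b := by
    refine ⟨_, hZc, ?_⟩
    rw [hx, add_mul, mul_add, smul_mul_assoc, mul_smul_comm, one_mul, mul_one]
    abel
  have hfin : finslerNorm b x = ‖Z‖ := by
    rw [hx, hb]
    exact finslerNorm_diagOp_eq e hC hlam hmin hcs hM hsum hZc
  have hx0 : x ≠ 0 := by
    intro h
    have h1 : finslerNorm b x ≤ 0 := by
      have h2 := finslerNorm_le (H := H) (c := b) (x := x) (Y := 0)
        ⟨isCompactOperator_zero, by simp⟩ (by simp [h])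
      simpa using h2
    rw [hfin] at h1
    exact hZ0 (norm_le_zero_iff.1 h1)
  have horb : ∀ t, σ t ∈ orbit A := fun t => by
    rw [hσ, ← conjCurve_add_smul_one Z b c t]
    exact conjCurve_mem_orbit hu hA hZc t
  refine ⟨⟨hZs, hmin, hZnc⟩, ⟨hZα ▸ hZc, fun t => ⟨?_, ?_, horb t⟩⟩, ⟨hσd, ?_, hxT⟩, ?_, ?_⟩
  · rw [hZα]
    exact exp_mem_fredholmUnitary (real_smul_mem_compactAntiHermitian hZc t)
  · rw [hσ, hZα, conjCurve_add_smul_one]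
  · have hD : dOp e γ * b = b * dOp e γ := by
      rw [hb]
      refine commute_diagOp e hd fun i j hij => ?_
      rw [hasMatrix_dOp e hγ1 i j, diagMatrix, if_neg hij]
    rw [hx, hZ, zOp, ← hY, add_mul, mul_add, hD]
    abel
  · intro t₀ ht₀
    have hsm : ∀ s t, IsSmoothCurve A σ s t := fun s t => by
      rw [hσ]
      exact isSmoothCurve_conjCurve hu hA hZs hZc (hx ▸ hx0) s t
    have hlen : curveLength σ 0 t₀ = ENNReal.ofReal (|t₀| * finslerNorm b x) := by
      rw [hσ, hx]
      exact curveLength_conjCurve hZs (hx ▸ hxT) t₀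
    have hσ0 : σ 0 = b := by rw [hσ, conjCurve_zero]
    have hnpos : 0 < ‖Z‖ := norm_pos_iff.2 hZ0
    have hangle : |t₀| * ‖Z‖ ≤ Real.pi / 2 := by
      calc |t₀| * ‖Z‖ ≤ Real.pi / (2 * ‖Z‖) * ‖Z‖ := by gcongr
        _ = Real.pi / 2 := by field_simp
    -- Stated for an arbitrary parameter interval, so that it bounds both the infimum on the fixed
    -- interval and `rectifiableDist`.
    have hlow : ∀ (β : ℝ → H →L[ℂ] H) (s t : ℝ), IsC1Curve A β s t → β s = b → β t = σ t₀ →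
        curveLength σ 0 t₀ ≤ curveLength β s t := by
      intro β s t hβ hs ht
      rw [hlen, hfin]
      have hE := exp_mem_unitary (star_real_smul hZs t₀)
      refine ofReal_angle_le_curveLength e hC hlam hu (hb ▸ hA) hβ (hb ▸ hs) hE ?_
        (by positivity) hangle ?_
      · rw [ht, hσ, conjCurve_eq hZs, ← hb]
      -- As `Z (e 0)` is orthogonal to `e 0`, the overlap is exactly `cos (t₀ ‖Z‖)`, nonnegative in
      -- the allowed range of `t₀`.
      · rw [star_exp (star_real_smul hZs t₀), exp_neg_smul_apply hZ0
          (antiHermitian_sq_apply hZs (norm_basis e 0) hnorm.symm), inner_sub_right,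
          inner_smul_right, inner_smul_right, hcol0, inner_basis, if_pos rfl, mul_one, mul_zero,
          sub_zero, Complex.norm_real, Real.norm_eq_abs, ← Real.cos_abs, abs_mul, abs_norm]
        exact abs_of_nonneg (Real.cos_nonneg_of_mem_Icc
          ⟨by linarith [Real.pi_pos, mul_nonneg (abs_nonneg t₀) (norm_nonneg Z)], hangle⟩)
    refine ⟨hsm 0 t₀, fun χ hχ h0 h1 => hlow χ 0 t₀ hχ h0 h1, ?_, ?_, hlen⟩
    · refine le_antisymm (le_iInf₂ fun χ hχ => hlow χ 0 t₀ hχ.1.isC1Curve hχ.2.1 hχ.2.2) ?_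
      exact iInf₂_le σ ⟨hsm 0 t₀, hσ0, rfl⟩
    · refine le_antisymm ?_ ?_
      · exact le_iInf₂ fun s t => le_iInf₂ fun β hβ =>
          hlow β s t hβ.1.isC1Curve hβ.2.1 hβ.2.2
      · exact (iInf₂_le 0 t₀).trans (iInf₂_le σ ⟨hsm 0 t₀, hσ0, rfl⟩)
  · refine ⟨⟨hZs, hx.symm, hfin.symm⟩, ?_⟩
    rintro ⟨Z', ⟨hs', hx', hn'⟩, hcpt⟩
    have hcomm : (Z' - Z) * b = b * (Z' - Z) := by
      rw [← sub_eq_zero, sub_mul, mul_sub]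
      calc _ = (Z' * b - b * Z') - (Z * b - b * Z) := by abel
        _ = 0 := by rw [hx', hx, sub_self]
    rw [hb] at hcomm
    -- `Z'` is `Z` plus a diagonal operator and has the same norm, so it equals `Z`, which is not
    -- compact.
    have hD : Z' - Z = 0 := eq_zero_of_norm_add_diagonal_eq e (j := 0) hZs hcol0 hnorm hcolne
      (by rw [add_sub_cancel]; exact hs')
      (fun i j hij => inner_eq_zero_of_commute_diagOp e hd hinj hcomm hij)
      (by rw [add_sub_cancel, hn', hfin])
    exact hZnc (sub_eq_zero.1 hD ▸ hcpt)
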